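/- Let $X$ be a standard Borel space. A Borel graph $\mathcal G$ on $X$ is a Borel, symmetric, irreflexive subset of $X\times X$; its connected components are called orbits, $B_R(x)$ is the closed ball of radius $R$ about $x$ in the shortest path metric, and $\mathcal G_A$ is the subgraph induced on $A\subseteq X$. A measured graph $(\mathcal G,X,\mu)$ is a Borel graph with a Borel probability measure $\mu$ such that some Borel action of a countable group $\Gamma$ with a symmetric generating system $\Sigma$ preserves the measure class of $\mu$ and defines $\mathcal G$, that is, $x\sim y$ iff $x\ne y$ and $y=\sigma x$ for some $\sigma\in\Sigma$. It is of bounded degree if the vertex degrees are uniformly bounded. It is of bounded type if it is of bounded degree and, for such an action of a finitely generated group with finite $\Sigma$, every Radon–Nikodym derivative $R_\gamma$ (where $\mu(\gamma A)=\int_A R_\gamma\,d\mu$) is essentially bounded. A $K$-separator is a Borel set $Y\subseteq X$ such that all components of $\mathcal G_{X\setminus Y}$ have at most $K$ vertices. A $K$-subset is a non-empty set $L\subseteq X$ with $|L|\le K$ and $\mathcal G_L$ connected; $\mathcal R_K$ is the Borel space of all $K$-subsets. Consider the following properties of a measured graph of bounded degree (all sets are Borel). 1. Uniform amenability: for every $\varepsilon>0$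 there is an integer $R\ge1$, an invariant set $Y\subseteq X$ (a union of orbits) with $\mu(Y)=1$ and a Borel function $p:Y\to\mathrm{Prob}(Y)$ such that for all $x\in Y$, $\mathrm{Supp}(p(x))\subseteq B_R(x)$ and $\sum_{y\sim x}\|p(x)-p(y)\|_1\le\varepsilon$. 2. Uniform local hyperfiniteness: for every $\varepsilon>0$ there is an integer $K\ge1$ such that every $B\subseteq X$ with $\mu(B)>0$ contains a set $A$ with $\mu(A)>0$, $\mu(\{x\in B\setminus A:\ x\sim y\text{ for some }y\in A\})<\varepsilon\mu(A)$, and all components of $\mathcal G_A$ of size at most $K$. 3. Uniform hyperfiniteness: for every $\varepsilon>0$ there is an integer $K\ge1$ such that every $A\subseteq X$ with $\mu(A)>0$ contains a set $T$ with $\mu(T)/\mu(A)<\varepsilon$ and all components of $\mathcal G_{A\setminus T}$ of size at most $K$. 4. Weighted hyperfiniteness: for every $\varepsilon>0$ there is an integer $K\ge1$ such that for every $\mu$-integrable $W:X\to[0,\infty)$ there is a $K$-separator $A$ with $\int_A W\,d\mu\le\varepsilon\int_X W\,d\mu$. 5. Approximate strong hyperfiniteness: for every $\varepsilon>0$ there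 is an integer $K\ge1$ such that the constant function $\varepsilon$ is the weak limit in $L^2(X,\mu)$ of a sequence of functions $\sum_{i=1}^{m_n}t^n_i\,c_{Y^n_i}+z^n$, where $t^n_i\ge0$, $\sum_i t^n_i=1$, $c_{Y^n_i}$ is the characteristic function of a $K$-separator $Y^n_i$, and $z^n$ is a non-negative bounded measurable function. 6. Strong fractional hyperfiniteness: for every $\varepsilon>0$ there are an integer $K\ge1$ and a measurable $\Phi:\mathcal R_K\to[0,\infty)$ such that for almost all $x\in X$, $\sum_{A\ni x}\Phi(A)=1$ and $\sum_{A:\,x\in\partial A}\Phi(A)\le\varepsilon$, where the sums run over $A\in\mathcal R_K$ and $\partial A$ is the set of vertices of $A$ with a neighbour outside $A$. Theorem. A measured graph $(\mathcal G,X,\mu)$ of bounded type is $\mu$-uniformly amenable if and only if it is $\mu$-uniformly hyperfinite; moreover, for measured graphs of bounded type all six properties 1–6 are equivalent. For every measured graph of bounded degree (not necessarily of bounded type), uniform amenability implies uniform hyperfiniteness. -/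

import Mathlib

open MeasureTheory Filter Topology
open scoped ENNReal NNReal

namespace UniformHyperfinite

universe u

section Basic

variable {X : Type u}

/-- The graph on `X` associated with an action of `Γ` and a symmetric generating system `S` is `G`:
distinct points `x, y` are adjacent iff `y = σ • x` for some `σ ∈ S`. -/
def IsActionGraph (G : SimpleGraph X) (Γ : Type) [Group Γ] [MulAction Γ X] (S : Set Γ) : Prop :=
  (∀ σ ∈ S, σ⁻¹ ∈ S) ∧ Subgroup.closure S = ⊤ ∧
    ∀ x y : X, G.Adj x y ↔ x ≠ y ∧ ∃ σ ∈ S, y = σ • x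

/-- All vertex degrees are at most some fixed integer. -/
def BoundedDegree (G : SimpleGraph X) : Prop :=
  ∃ d : ℕ, ∀ x : X, (G.neighborSet x).encard ≤ d

/-- All components of the induced graph `G_S` have at most `K` vertices. -/
def ComponentsAtMost (G : SimpleGraph X) (S : Set X) (K : ℕ) : Prop :=
  ∀ C : (G.induce S).ConnectedComponent, C.supp.encard ≤ K

/-- The closed ball of radius `R` about `x` in the shortest path metric of the orbit of `x`. -/
def graphBall (G : SimpleGraph X) (x : X) (R : ℕ) : Set X :=
  {y | G.edist x y ≤ R}

/-- A union of orbits (connected components) of `G`. -/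
def IsInvariant (G : SimpleGraph X) (Y : Set X) : Prop :=
  ∀ x ∈ Y, ∀ y, G.Reachable x y → y ∈ Y

/-- The outer boundary of `A` inside `B`: points of `B \ A` having a neighbour in `A`. -/
def outerBoundary (G : SimpleGraph X) (B A : Set X) : Set X :=
  {x | x ∈ B \ A ∧ ∃ y ∈ A, G.Adj x y}

/-- The inner boundary of `A`: points of `A` having a neighbour outside `A`. -/
def innerBoundary (G : SimpleGraph X) (A : Set X) : Set X :=
  {x | x ∈ A ∧ ∃ y, y ∉ A ∧ G.Adj x y}

/-- The `K`-subsets: finite sets with at most `K` elements inducing a connected graph. -/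
def KSubset (G : SimpleGraph X) (K : ℕ) : Type u :=
  {L : Finset X // L.card ≤ K ∧ (G.induce (L : Set X)).Connected}

/-- `Φ^*(x)`, the sum of `Φ` over the `K`-subsets containing `x`. -/
noncomputable def starSum (G : SimpleGraph X) (K : ℕ) (Φ : KSubset G K → ℝ) (x : X) : ℝ :=
  ∑' A : {A : KSubset G K // x ∈ A.1}, Φ A.1

/-- `∂Φ(x)`, the sum of `Φ` over the `K`-subsets having `x` in their inner boundary. -/
noncomputable def boundarySum (G : SimpleGraph X) (K : ℕ) (Φ : KSubset G K → ℝ) (x : X) : ℝ :=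
  ∑' A : {A : KSubset G K // x ∈ innerBoundary G (A.1 : Set X)}, Φ A.1

end Basic

section Measurable

variable {X : Type u} [MeasurableSpace X]

/-- The `Γ`-action is by Borel maps and preserves null sets of `μ`. -/
def IsMeasureClassPreserving (μ : Measure X) (Γ : Type) [Group Γ] [MulAction Γ X] : Prop :=
  (∀ γ : Γ, Measurable (fun x : X => γ • x)) ∧
    ∀ (γ : Γ) (A : Set X), MeasurableSet A → μ A = 0 → μ ((fun x : X => γ • x) '' A) = 0

/-- The Radon–Nikodym derivative `R_γ`, given by `μ(γA) = ∫_A R_γ dμ`: the measure `A ↦ μ(γA)` is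
the push-forward of `μ` under `γ⁻¹`. -/
noncomputable def cocycle (μ : Measure X) {Γ : Type} [Group Γ] [MulAction Γ X] (γ : Γ) :
    X → ℝ≥0∞ :=
  (μ.map (fun x : X => γ⁻¹ • x)).rnDeriv μ

/-- A Borel graph with a quasi-invariant measure: `G` is a Borel subset of `X × X`, and it is the
graph of a Borel action of a countable group that preserves the measure class of `μ`. -/
def IsMeasuredGraph (G : SimpleGraph X) (μ : Measure X) : Prop :=
  MeasurableSet {q : X × X | G.Adj q.1 q.2} ∧
    ∃ (Γ : Type) (_ : Group Γ) (_ : Countable Γ) (_ : MulAction Γ X) (S : Set Γ),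
      IsActionGraph G Γ S ∧ IsMeasureClassPreserving μ Γ

/-- Bounded type: bounded degrees, and for an action of a finitely generated group (with finite
generating system) defining `G`, every `R_γ` is (essentially) bounded. -/
def IsBoundedType (G : SimpleGraph X) (μ : Measure X) : Prop :=
  IsMeasuredGraph G μ ∧ BoundedDegree G ∧
    ∃ (Γ : Type) (_ : Group Γ) (_ : MulAction Γ X) (S : Set Γ),
      S.Finite ∧ IsActionGraph G Γ S ∧ IsMeasureClassPreserving μ Γ ∧
        ∀ γ : Γ, ∃ C : ℝ≥0, ∀ᵐ x ∂μ, cocycle μ γ x ≤ C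

/-! ### Uniform amenability -/

/-- `(ε, R)`-uniform amenability. The Borel function `p : Y → Prob(Y)` is given by its values
`p x z = p(x)({z})`. -/
def IsUniformlyAmenableWith (G : SimpleGraph X) (μ : Measure X) (ε : ℝ) (R : ℕ) : Prop :=
  ∃ Y : Set X, MeasurableSet Y ∧ IsInvariant G Y ∧ μ Y = 1 ∧
    ∃ p : X → X → ℝ, Measurable (fun q : X × X => p q.1 q.2) ∧
      ∀ x ∈ Y, (∀ z, 0 ≤ p x z) ∧ HasSum (p x) 1 ∧
        Function.support (p x) ⊆ graphBall G x R ∧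
        ∑' y : G.neighborSet x, ∑' z, |p x z - p y z| ≤ ε

/-- `μ`-uniform amenability. -/
def IsUniformlyAmenable (G : SimpleGraph X) (μ : Measure X) : Prop :=
  ∀ ε : ℝ, 0 < ε → ∃ R : ℕ, 1 ≤ R ∧ IsUniformlyAmenableWith G μ ε R

/-! ### Uniform local hyperfiniteness -/

/-- `(ε, K)`-local hyperfiniteness. -/
def IsLocallyHyperfiniteWith (G : SimpleGraph X) (μ : Measure X) (ε : ℝ) (K : ℕ) : Prop :=
  ∀ B : Set X, MeasurableSet B → 0 < μ B →
    ∃ A : Set X, MeasurableSet A ∧ A ⊆ B ∧ 0 < μ A ∧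
      μ (outerBoundary G B A) < ENNReal.ofReal ε * μ A ∧ ComponentsAtMost G A K

/-- `μ`-uniform local hyperfiniteness. -/
def IsUniformlyLocallyHyperfinite (G : SimpleGraph X) (μ : Measure X) : Prop :=
  ∀ ε : ℝ, 0 < ε → ∃ K : ℕ, 1 ≤ K ∧ IsLocallyHyperfiniteWith G μ ε K

/-! ### Uniform hyperfiniteness -/

/-- The induced measured graph `(G_A, A, μ_A)`, where `μ_A(B) = μ(B) / μ(A)`, is
`(ε, K)`-hyperfinite. -/
def IsHyperfiniteOn (G : SimpleGraph X) (μ : Measure X) (A : Set X) (ε : ℝ) (K : ℕ) : Prop :=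
  ∃ T : Set X, MeasurableSet T ∧ T ⊆ A ∧ μ T / μ A < ENNReal.ofReal ε ∧
    ComponentsAtMost G (A \ T) K

/-- `μ`-uniform hyperfiniteness: every induced subgraph of positive measure is
`(ε, K)`-hyperfinite. -/
def IsUniformlyHyperfinite (G : SimpleGraph X) (μ : Measure X) : Prop :=
  ∀ ε : ℝ, 0 < ε → ∃ K : ℕ, 1 ≤ K ∧
    ∀ A : Set X, MeasurableSet A → 0 < μ A → IsHyperfiniteOn G μ A ε K

/-! ### Weighted hyperfiniteness -/

/-- A `K`-separator: a Borel set whose removal leaves components of size at most `K`. -/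
def IsSeparator (G : SimpleGraph X) (K : ℕ) (Y : Set X) : Prop :=
  MeasurableSet Y ∧ ComponentsAtMost G Yᶜ K

/-- `(ε, K)`-weighted hyperfiniteness. -/
def IsWeightedHyperfiniteWith (G : SimpleGraph X) (μ : Measure X) (ε : ℝ) (K : ℕ) : Prop :=
  ∀ W : X → ℝ, (∀ x, 0 ≤ W x) → Integrable W μ →
    ∃ A : Set X, IsSeparator G K A ∧ ∫ x in A, W x ∂μ ≤ ε * ∫ x, W x ∂μ

/-- `μ`-weighted hyperfiniteness. -/
def IsWeightedHyperfinite (G : SimpleGraph X) (μ : Measure X) : Prop :=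
  ∀ ε : ℝ, 0 < ε → ∃ K : ℕ, 1 ≤ K ∧ IsWeightedHyperfiniteWith G μ ε K

/-! ### Approximate strong hyperfiniteness -/

/-- A function of the form `∑ i, t i • c_{Y i} + z`: a finite convex combination of characteristic
functions of `K`-separators plus a non-negative bounded measurable function. -/
def IsSeparatorCombination (G : SimpleGraph X) (K : ℕ) (f : X → ℝ) : Prop :=
  ∃ (m : ℕ) (t : Fin m → ℝ) (Y : Fin m → Set X) (z : X → ℝ),
    (∀ i, 0 ≤ t i) ∧ ∑ i, t i = 1 ∧ (∀ i, IsSeparator G K (Y i)) ∧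
    Measurable z ∧ (∀ x, 0 ≤ z x) ∧ (∃ c : ℝ, ∀ x, z x ≤ c) ∧
    ∀ x, f x = ∑ i, t i * (Y i).indicator (fun _ => (1 : ℝ)) x + z x

/-- `(ε, K)`-approximate strong hyperfiniteness: the constant `ε` is the weak limit in `L²(X, μ)`
of a sequence of such functions. -/
def IsApproxStronglyHyperfiniteWith (G : SimpleGraph X) (μ : Measure X) (ε : ℝ) (K : ℕ) : Prop :=
  ∃ f : ℕ → X → ℝ, (∀ n, IsSeparatorCombination G K (f n)) ∧
    ∀ h : X → ℝ, MemLp h 2 μ →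
      Tendsto (fun n => ∫ x, f n x * h x ∂μ) atTop (𝓝 (∫ x, ε * h x ∂μ))

/-- `μ`-approximate strong hyperfiniteness. -/
def IsApproxStronglyHyperfinite (G : SimpleGraph X) (μ : Measure X) : Prop :=
  ∀ ε : ℝ, 0 < ε → ∃ K : ℕ, 1 ≤ K ∧ IsApproxStronglyHyperfiniteWith G μ ε K

/-! ### Strong fractional hyperfiniteness -/

open Classical in
/-- The Borel structure on finite subsets of `X`: the quotient structure under the maps
`(x₁, …, xₙ) ↦ {x₁, …, xₙ}`, `n = 0, 1, 2, …`. -/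
noncomputable abbrev finsetMeasurableSpace : MeasurableSpace (Finset X) :=
  ⨅ n : ℕ, MeasurableSpace.map (fun v : Fin n → X => Finset.univ.image v) MeasurableSpace.pi

/-- The space of `K`-subsets carries the induced Borel structure. -/
noncomputable instance instMeasurableSpaceKSubset (G : SimpleGraph X) (K : ℕ) :
    MeasurableSpace (KSubset G K) :=
  MeasurableSpace.comap Subtype.val (finsetMeasurableSpace (X := X))

/-- Fractional `K`-partitions: non-negative measurable `Φ` with `Φ^* = 1` almost everywhere. -/
def IsFractionalPartition (G : SimpleGraph X) (μ : Measure X) (K : ℕ)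
    (Φ : KSubset G K → ℝ) : Prop :=
  Measurable Φ ∧ (∀ A, 0 ≤ Φ A) ∧ ∀ᵐ x ∂μ, starSum G K Φ x = 1

/-- `(ε, K)`-strong fractional hyperfiniteness. -/
def IsStronglyFractionallyHyperfiniteWith (G : SimpleGraph X) (μ : Measure X) (ε : ℝ) (K : ℕ) :
    Prop :=
  ∃ Φ : KSubset G K → ℝ, IsFractionalPartition G μ K Φ ∧ ∀ᵐ x ∂μ, boundarySum G K Φ x ≤ ε

/-- Strong fractional `μ`-hyperfiniteness. -/
def IsStronglyFractionallyHyperfinite (G : SimpleGraph X) (μ : Measure X) : Prop :=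
  ∀ ε : ℝ, 0 < ε → ∃ K : ℕ, 1 ≤ K ∧ IsStronglyFractionallyHyperfiniteWith G μ ε K

end Measurable

end UniformHyperfinite

/-! The six properties are linked in one cycle, 1 → 2 → 3 → 4 → 5 → 6 → 1. The first two steps need
no bound on Radon–Nikodym derivatives, which gives the statement for bounded degree.

1 → 2 (`exists_superlevel_outerBoundary_lt`). Colour `X` so that points at distance at most `2R+1`
get different colours, and let `q i x` be the mass that `p x` gives to the only point of colour `i`
near `x`. The `q i` sum to 1 and their oscillations along edges have small sum, so by the layer-cake
formula some superlevel set of some `q i` has small boundary in `B`. Its components are small,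
because adjacent points share the same nearby point of colour `i`.

2 → 3 (`IsLocallyHyperfiniteWith.exists_separating`). A greedy exhaustion cuts out nearly maximal
pieces with small boundary; the boundaries form the set to be removed.

3 → 4 (`exists_separator_withDensity_le`). Cut the range of `W` into geometric levels, delete a
cheap residue class of levels and the points with a much heavier neighbour, and treat each remaining
block of levels, where `W` is nearly constant, by uniform hyperfiniteness. This is the only
quantitative use of the bounded derivatives.

4 → 5 is Hahn–Banach in `L²`: a functional separating `ε` from all separator combinations would be a
non-negative weight violating 4.

5 → 6. By convexity the weak limit can be replaced by an almost everywhere limit. A `K`-separator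
partitions `X` into `K`-subsets, convex combinations of separators give fractional partitions, and
convex combinations of these converge almost everywhere to the required `Φ`
(`exists_convexHull_tendsto_ae`).

6 → 1. Let `p x` be the `Φ`-average of the uniform measures on the `K`-subsets containing `x`. Only
sets containing exactly one of two neighbours contribute to the difference of their measures, and
these are counted by `boundarySum`. -/

namespace UniformHyperfinite

universe u

/-! ### Paths inside a set, component bounds, balls and words in the generators. -/

section Graphs

variable {X : Type u} {G : SimpleGraph X}

/-- `x` and `y` are joined by a path of `G` inside `S` (or are equal). -/
def JoinedIn (G : SimpleGraph X) (S : Set X) : X → X → Prop :=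
  Relation.ReflTransGen fun a b => G.Adj a b ∧ a ∈ S ∧ b ∈ S

theorem JoinedIn.mem {S : Set X} {x y : X} (h : JoinedIn G S x y) (hx : x ∈ S) : y ∈ S := by
  induction h with
  | refl => exact hx
  | tail _ h _ => exact h.2.2

theorem reachable_induce_iff {S : Set X} (x y : S) :
    (G.induce S).Reachable x y ↔ JoinedIn G S x y := by
  rw [SimpleGraph.reachable_iff_reflTransGen]
  constructor
  · intro h
    refine Relation.ReflTransGen.lift (Subtype.val : S → X) (fun a b hab => ?_) x y h
    exact ⟨hab, a.2, b.2⟩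
  · obtain ⟨x, hx⟩ := x
    obtain ⟨y, hy⟩ := y
    intro h
    change JoinedIn G S x y at h
    induction h with
    | refl => exact .refl
    | tail _ h ih => exact (ih h.2.1).tail (by simpa using h.1)

theorem componentsAtMost_iff {S : Set X} {K : ℕ} :
    ComponentsAtMost G S K ↔ ∀ x ∈ S, {y | JoinedIn G S x y}.encard ≤ K := by
  have key : ∀ x : S, ((G.induce S).connectedComponentMk x).supp.encard
      = {y | JoinedIn G S x y}.encard := by
    intro x
    rw [← Subtype.val_injective.encard_image]
    congr 1
    ext y
    simp only [Set.mem_image, SimpleGraph.ConnectedComponent.mem_supp_iff,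
      SimpleGraph.ConnectedComponent.eq, Set.mem_ofPred_eq, Subtype.exists, exists_and_right,
      exists_eq_right]
    constructor
    · rintro ⟨hy, h⟩
      exact (reachable_induce_iff _ _).1 h.symm
    · intro h
      exact ⟨h.mem x.2, ((reachable_induce_iff x ⟨y, h.mem x.2⟩).2 h).symm⟩
  constructor
  · intro h x hx
    rw [← key ⟨x, hx⟩]
    exact h _
  · intro h C
    induction C using SimpleGraph.ConnectedComponent.ind with
    | _ x => rw [key x]; exact h x x.2

theorem JoinedIn.label_eq {α : Type*} {S : Set X} {f : X → α}
    (hf : ∀ x ∈ S, ∀ y ∈ S, G.Adj x y → f x = f y) {x y : X} (h : JoinedIn G S x y) :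
    f y = f x := by
  induction h with
  | refl => rfl
  | tail _ h ih => rw [← ih, hf _ h.2.1 _ h.2.2 h.1]

/-- A label that is constant along edges is constant on components, so each component lies in one
fibre. -/
theorem componentsAtMost_of_label {α : Type*} {S : Set X} {K : ℕ} (f : X → α)
    (hf : ∀ x ∈ S, ∀ y ∈ S, G.Adj x y → f x = f y)
    (hK : ∀ x ∈ S, {y | y ∈ S ∧ f y = f x}.encard ≤ K) : ComponentsAtMost G S K := by
  rw [componentsAtMost_iff]
  intro x hx
  exact (Set.encard_le_encard fun y (hy : JoinedIn G S x y) =>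
    (⟨hy.mem hx, hy.label_eq hf⟩ : y ∈ S ∧ f y = f x)).trans (hK x hx)

/-- Here fibres may be infinite: a path in `S` never leaves its fibre, hence is also a path in the
piece `S'`, whose components are already known to be small. -/
theorem componentsAtMost_of_label_of_pieces {α : Type*} {S : Set X} {K : ℕ} (f : X → α)
    (hf : ∀ x ∈ S, ∀ y ∈ S, G.Adj x y → f x = f y)
    (hK : ∀ x ∈ S, ∃ S', {y | y ∈ S ∧ f y = f x} ⊆ S' ∧ ComponentsAtMost G S' K) :
    ComponentsAtMost G S K := by
  rw [componentsAtMost_iff]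
  intro x hx
  obtain ⟨S', hS', h⟩ := hK x hx
  rw [componentsAtMost_iff] at h
  refine (Set.encard_le_encard fun y hy => ?_).trans (h x (hS' ⟨hx, rfl⟩))
  have hy' : JoinedIn G S x y := hy
  change JoinedIn G S' x y
  clear hy
  induction hy' with
  | refl => exact .refl
  | @tail b c hb h ih =>
    exact ih.tail ⟨h.1, hS' ⟨h.2.1, JoinedIn.label_eq hf hb⟩,
      hS' ⟨h.2.2, JoinedIn.label_eq hf (hb.tail h)⟩⟩

theorem exists_walk_of_mem_graphBall {x y : X} {R : ℕ} (h : y ∈ graphBall G x R) :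
    ∃ p : G.Walk x y, p.length ≤ R := by
  have h' : G.edist x y ≤ R := h
  have hr : G.Reachable x y := SimpleGraph.edist_ne_top_iff_reachable.1
    (ne_top_of_le_ne_top (by simp) h')
  obtain ⟨p, hp⟩ := hr.exists_walk_length_eq_edist
  exact ⟨p, by rw [← hp] at h'; exact_mod_cast h'⟩

theorem mem_graphBall_of_walk {x y : X} {R : ℕ} (p : G.Walk x y) (hp : p.length ≤ R) :
    y ∈ graphBall G x R :=
  (SimpleGraph.edist_le p).trans (by exact_mod_cast hp)

theorem BoundedDegree.exists_card_graphBall_le (h : BoundedDegree G) (R : ℕ) :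
    ∃ K : ℕ, ∀ x : X, ∃ F : Finset X, F.card ≤ K ∧ graphBall G x R ⊆ F := by
  classical
  obtain ⟨d, hd⟩ := h
  have hfin : ∀ x, ∃ F : Finset X, F.card ≤ d ∧ ∀ y, G.Adj x y → y ∈ F := by
    intro x
    have hf : (G.neighborSet x).Finite := Set.finite_of_encard_le_coe (hd x)
    refine ⟨hf.toFinset, ?_, fun y hy => by simpa using hy⟩
    have := hd x
    rw [hf.encard_eq_coe_toFinset_card] at this
    exact_mod_cast this
  choose N hN hN' using hfin
  induction R with
  | zero =>
    refine ⟨1, fun x => ⟨{x}, by simp, fun y hy => ?_⟩⟩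
    obtain ⟨p, hp⟩ := exists_walk_of_mem_graphBall hy
    have := SimpleGraph.Walk.eq_of_length_eq_zero (Nat.le_zero.1 hp)
    simp [this]
  | succ R ih =>
    obtain ⟨K, hK⟩ := ih
    choose F hF hF' using hK
    refine ⟨1 + d * K, fun x => ⟨{x} ∪ (N x).biUnion F, ?_, fun y hy => ?_⟩⟩
    · refine (Finset.card_union_le _ _).trans ?_
      simp only [Finset.card_singleton]
      gcongr
      exact (Finset.card_biUnion_le_card_mul _ _ K fun y _ => hF y).trans
        (Nat.mul_le_mul_right _ (hN x))
    · obtain ⟨p, hp⟩ := exists_walk_of_mem_graphBall hy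
      cases p with
      | nil => simp
      | @cons _ v _ hv q =>
        have hq : y ∈ graphBall G v R := mem_graphBall_of_walk q (by simpa using hp)
        simp only [Finset.coe_union, Finset.coe_singleton, Finset.coe_biUnion]
        right
        simp only [Set.mem_iUnion]
        exact ⟨v, hN' x v hv, hF' v hq⟩

/-- The composition of the maps `s i` along a word. -/
def wordMap {ι : Type*} (s : ι → X → X) (l : List ι) (x : X) : X :=
  l.foldl (fun y i => s i y) x

theorem measurable_wordMap [MeasurableSpace X] {ι : Type*} {s : ι → X → X}
    (hs : ∀ i, Measurable (s i)) (l : List ι) : Measurable (wordMap s l) := by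
  induction l with
  | nil => exact measurable_id
  | cons i l ih => exact ih.comp (hs i)

theorem exists_wordMap_eq_of_walk {ι : Type*} {s : ι → X → X}
    (hs : ∀ x y, G.Adj x y → ∃ i, y = s i x) {x y : X} (p : G.Walk x y) :
    ∃ l : List ι, l.length = p.length ∧ wordMap s l x = y := by
  induction p with
  | nil => exact ⟨[], rfl, rfl⟩
  | cons h p ih =>
    obtain ⟨l, hl, hl'⟩ := ih
    obtain ⟨i, rfl⟩ := hs _ _ h
    exact ⟨i :: l, by simp [hl], hl'⟩

theorem wordMap_mem_graphBall {ι : Type*} {s : ι → X → X}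
    (hs : ∀ x y, G.Adj x y ↔ x ≠ y ∧ ∃ i, y = s i x) {l : List ι} {R : ℕ} (hl : l.length ≤ R)
    (x : X) : wordMap s l x ∈ graphBall G x R := by
  obtain ⟨p, hp⟩ : ∃ p : G.Walk x (wordMap s l x), p.length ≤ l.length := by
    clear hl
    induction l generalizing x with
    | nil => exact ⟨.nil, le_rfl⟩
    | cons i l ih =>
      obtain ⟨p, hp⟩ := ih (s i x)
      change ∃ p : G.Walk x (wordMap s l (s i x)), p.length ≤ l.length + 1
      generalize wordMap s l (s i x) = z at p hp ⊢
      by_cases h : x = s i x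
      · refine ⟨p.copy h.symm rfl, ?_⟩
        rw [SimpleGraph.Walk.length_copy]
        omega
      · refine ⟨.cons ((hs _ _).2 ⟨h, i, rfl⟩) p, ?_⟩
        rw [SimpleGraph.Walk.length_cons]
        omega
  exact mem_graphBall_of_walk p (hp.trans hl)

/-- In a graph generated by finitely many maps, balls are covered by the values of finitely many
maps. -/
theorem exists_maps_graphBall_subset [MeasurableSpace X] {ι : Type*} [Finite ι] {s : ι → X → X}
    (hm : ∀ i, Measurable (s i)) (hs : ∀ x y, G.Adj x y → ∃ i, y = s i x) (R : ℕ) :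
    ∃ (N : ℕ) (φ : Fin N → X → X), (∀ j, Measurable (φ j)) ∧
      ∀ x, ∀ y ∈ graphBall G x R, ∃ j, y = φ j x := by
  have : Finite {l : List ι | l.length ≤ R} := List.finite_length_le ι R
  obtain ⟨N, ⟨e⟩⟩ := Finite.exists_equiv_fin {l : List ι | l.length ≤ R}
  refine ⟨N, fun j => wordMap s (e.symm j).1, fun j => measurable_wordMap hm _, fun x y hy => ?_⟩
  obtain ⟨p, hp⟩ := exists_walk_of_mem_graphBall hy
  obtain ⟨l, hl, hl'⟩ := exists_wordMap_eq_of_walk hs p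
  exact ⟨e ⟨l, hl.trans_le hp⟩, by simp [hl']⟩

theorem IsInvariant.mem_of_adj {Y : Set X} (h : IsInvariant G Y) {x y : X} (hx : x ∈ Y)
    (hxy : G.Adj x y) : y ∈ Y :=
  h x hx y hxy.reachable

theorem isInvariant_of_adj {Y : Set X} (h : ∀ x ∈ Y, ∀ y, G.Adj x y → y ∈ Y) :
    IsInvariant G Y := by
  rintro x hx y ⟨p⟩
  induction p with
  | nil => exact hx
  | cons hv _ ih => exact ih (h _ hx _ hv)

end Graphs

/-! ### Measurable generating maps and what quasi-invariance says about them. -/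

section Generators

variable {X : Type u} [MeasurableSpace X] {G : SimpleGraph X} {μ : Measure X}

theorem IsMeasuredGraph.exists_maps (h : IsMeasuredGraph G μ) :
    ∃ s : ℕ → X → X, (∀ i, Measurable (s i)) ∧ (∀ i, μ.map (s i) ≪ μ) ∧
      ∀ x y, G.Adj x y ↔ x ≠ y ∧ ∃ i, y = s i x := by
  obtain ⟨-, Γ, _, _, _, S, ⟨-, -, hadj⟩, hm, hnull⟩ := h
  -- Adjoining `1` makes the set non-empty, so that it can be enumerated by `ℕ`; it creates no edge,
  -- since adjacency requires `x ≠ y`.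
  obtain ⟨e, he⟩ := (Set.to_countable (insert 1 S)).exists_eq_range ⟨1, by simp⟩
  refine ⟨fun i x => e i • x, fun i => hm _, fun i => ?_, fun x y => ?_⟩
  · refine Measure.AbsolutelyContinuous.mk fun A hA h0 => ?_
    rw [Measure.map_apply (hm _) hA]
    convert hnull (e i)⁻¹ A hA h0 using 2
    ext x
    simp only [Set.mem_preimage, Set.mem_image]
    exact ⟨fun h => ⟨_, h, by simp⟩, by rintro ⟨y, hy, rfl⟩; simpa using hy⟩
  · rw [hadj]
    refine and_congr_right fun hxy => ⟨?_, ?_⟩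
    · rintro ⟨σ, hσ, rfl⟩
      have : σ ∈ Set.range e := he ▸ Set.mem_insert_of_mem _ hσ
      obtain ⟨i, rfl⟩ := this
      exact ⟨i, rfl⟩
    · rintro ⟨i, rfl⟩
      have : e i ∈ insert 1 S := he ▸ Set.mem_range_self i
      rcases this with h | h
      · simp [h] at hxy
      · exact ⟨_, h, rfl⟩

theorem IsBoundedType.exists_maps [IsFiniteMeasure μ] (h : IsBoundedType G μ) :
    ∃ (m : ℕ) (s : Fin m → X → X) (C : ℝ≥0), (∀ i, Measurable (s i)) ∧
      (∀ i, μ.map (s i) ≤ C • μ) ∧ ∀ x y, G.Adj x y ↔ x ≠ y ∧ ∃ i, y = s i x := by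
  obtain ⟨-, -, Γ, _, _, S, hfin, ⟨-, -, hadj⟩, ⟨hm, hnull⟩, hC⟩ := h
  choose c hc using hC
  have : Finite S := hfin
  obtain ⟨m, ⟨e⟩⟩ := Finite.exists_equiv_fin S
  -- The push-forward under `σ` has density `cocycle μ σ⁻¹`, hence the inverses; summing gives one
  -- constant for all generators.
  refine ⟨m, fun i x => (e.symm i).1 • x, ∑ i, c (e.symm i).1⁻¹, fun i => hm _, fun i => ?_,
    fun x y => ?_⟩
  · set σ := (e.symm i).1 with hσ
    have hac : μ.map (fun x : X => σ • x) ≪ μ := by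
      refine Measure.AbsolutelyContinuous.mk fun A hA h0 => ?_
      rw [Measure.map_apply (hm _) hA]
      convert hnull σ⁻¹ A hA h0 using 2
      ext x
      simp only [Set.mem_preimage, Set.mem_image]
      exact ⟨fun h => ⟨_, h, by simp⟩, by rintro ⟨y, hy, rfl⟩; simpa using hy⟩
    have h1 := hc σ⁻¹
    unfold cocycle at h1
    simp only [inv_inv] at h1
    have hle : c σ⁻¹ ≤ ∑ i, c (e.symm i).1⁻¹ :=
      Finset.single_le_sum (f := fun i => c (e.symm i).1⁻¹) (fun _ _ => zero_le) (Finset.mem_univ i)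
    have : IsFiniteMeasure (μ.map (fun x : X => σ • x)) := Measure.isFiniteMeasure_map _ _
    rw [← Measure.withDensity_rnDeriv_eq _ _ hac]
    calc μ.withDensity ((μ.map (fun x : X => σ • x)).rnDeriv μ)
        ≤ μ.withDensity (fun _ => (c σ⁻¹ : ℝ≥0∞)) := withDensity_mono h1
      _ = c σ⁻¹ • μ := by rw [withDensity_const]; rfl
      _ ≤ _ := by
        refine Measure.le_iff.2 fun A _ => ?_
        simp only [Measure.smul_apply, ENNReal.smul_def, smul_eq_mul]
        gcongr
  · rw [hadj]
    refine and_congr_right fun hxy => ⟨?_, ?_⟩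
    · rintro ⟨σ, hσ, rfl⟩
      exact ⟨e ⟨σ, hσ⟩, by simp⟩
    · rintro ⟨i, rfl⟩
      exact ⟨_, (e.symm i).2, rfl⟩

end Generators

/-! ### Borel colourings separating nearby points. -/

section Coloring

variable {X : Type u} [MeasurableSpace X] {G : SimpleGraph X}

/-- A Borel graph of bounded degree generated by countably many Borel maps has a Borel colouring
with countably many colours in which points at distance at most `R` have different colours. -/
theorem exists_measurable_coloring [StandardBorelSpace X] (hd : BoundedDegree G)
    {s : ℕ → X → X} (hm : ∀ i, Measurable (s i))
    (hs : ∀ x y, G.Adj x y ↔ x ≠ y ∧ ∃ i, y = s i x) (R : ℕ) :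
    ∃ c : X → ℕ, Measurable c ∧ ∀ x, ∀ y ∈ graphBall G x R, x ≠ y → c x ≠ c y := by
  classical
  let _ := upgradeStandardBorel X
  obtain ⟨U, hU⟩ := ((TopologicalSpace.countable_countableBasis X).insert Set.univ).exists_eq_range
    ⟨_, Set.mem_insert _ _⟩
  have hUb := TopologicalSpace.isBasis_countableBasis X
  have hUo : ∀ k, IsOpen (U k) := by
    intro k
    have hk : U k ∈ insert Set.univ (TopologicalSpace.countableBasis X) :=
      hU ▸ Set.mem_range_self k
    rcases hk with h | h
    · exact h ▸ isOpen_univ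
    · exact hUb.isOpen h
  obtain ⟨K, hK⟩ := hd.exists_card_graphBall_le R
  -- The colour of `x` is the least index of a basic open set isolating `x` in its finite `R`-ball.
  -- Quantifying over words instead of points of the ball makes the condition Borel.
  have hex : ∀ x, ∃ k, x ∈ U k ∧ ∀ l : List ℕ, l.length ≤ R →
      wordMap s l x = x ∨ wordMap s l x ∉ U k := by
    intro x
    obtain ⟨F, -, hF⟩ := hK x
    have ho : IsOpen ((F.erase x : Finset X) : Set X)ᶜ :=
      (Finset.finite_toSet _).isClosed.isOpen_compl
    obtain ⟨V, hV, hxV, hVs⟩ := hUb.exists_subset_of_mem_open (a := x) (by simp) ho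
    obtain ⟨k, rfl⟩ : V ∈ Set.range U := hU ▸ Set.mem_insert_of_mem _ hV
    refine ⟨k, hxV, fun l hl => ?_⟩
    by_contra! hcon
    have := hVs hcon.2
    simp only [Finset.coe_erase, Set.mem_compl_iff, Set.mem_sdiff, Set.mem_singleton_iff,
      not_and, not_not] at this
    exact hcon.1 (this (hF (wordMap_mem_graphBall hs hl x)))
  refine ⟨fun x => Nat.find (hex x), measurable_find _ fun k => ?_, ?_⟩
  · have : {x | x ∈ U k ∧ ∀ l : List ℕ, l.length ≤ R → wordMap s l x = x ∨ wordMap s l x ∉ U k} =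
        U k ∩ ⋂ (l : List ℕ), ⋂ (_ : l.length ≤ R),
          ({x | wordMap s l x = x} ∪ (wordMap s l ⁻¹' U k)ᶜ) := by
      ext x; simp
    rw [this]
    refine MeasurableSet.inter (hUo k).measurableSet ?_
    refine MeasurableSet.iInter fun l => MeasurableSet.iInter fun _ => MeasurableSet.union ?_ ?_
    · exact measurableSet_eq_fun (measurable_wordMap hm l) measurable_id
    · exact ((hUo k).measurableSet.preimage (measurable_wordMap hm l)).compl
  · intro x y hy hxy hc
    have h1 := Nat.find_spec (hex x)
    have h2 := Nat.find_spec (hex y)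
    change Nat.find (hex x) = Nat.find (hex y) at hc
    obtain ⟨p, hp⟩ := exists_walk_of_mem_graphBall hy
    obtain ⟨l, hl, rfl⟩ := exists_wordMap_eq_of_walk (fun x y h => ((hs x y).1 h).2) p
    rcases h1.2 l (hl.trans_le hp) with h | h
    · exact hxy h.symm
    · rw [hc] at h
      exact h h2.1

end Coloring

/-! ### Layer-cake formula for extended non-negative functions. -/

section LayerCake

theorem lintegral_eq_lintegral_measure_ofReal_lt {Ω : Type*} [MeasurableSpace Ω] {ν : Measure Ω}
    {f : Ω → ℝ≥0∞} (hf : Measurable f) (hfin : ∀ᵐ x ∂ν, f x ≠ ⊤) :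
    ∫⁻ x, f x ∂ν = ∫⁻ t in Set.Ioi (0 : ℝ), ν {x | ENNReal.ofReal t < f x} := by
  have h := lintegral_eq_lintegral_meas_lt ν (f := fun x => (f x).toReal)
    (Eventually.of_forall fun _ => ENNReal.toReal_nonneg) hf.ennreal_toReal.aemeasurable
  calc ∫⁻ x, f x ∂ν = ∫⁻ x, ENNReal.ofReal (f x).toReal ∂ν :=
        lintegral_congr_ae (hfin.mono fun x hx => (ENNReal.ofReal_toReal hx).symm)
    _ = _ := h
    _ = _ := by
      refine setLIntegral_congr_fun measurableSet_Ioi fun t ht => ?_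
      refine measure_congr (hfin.mono fun x hx => propext ?_)
      exact (ENNReal.ofReal_lt_iff_lt_toReal (le_of_lt ht) hx).symm

end LayerCake

/-! ### Selecting a superlevel set with small boundary. -/

section Local

variable {X : Type u} [MeasurableSpace X] {G : SimpleGraph X} {μ : Measure X}

open Classical in
/-- If the functions `q i` sum to `1` and the sum of the excesses of `q i` at neighbours is at most
`δ < ε`, then some superlevel set of some `q i` in `B` has small outer boundary in `B`. -/
theorem exists_superlevel_outerBoundary_lt [IsFiniteMeasure μ] {s : ℕ → X → X}
    (hm : ∀ i, Measurable (s i)) (hG : MeasurableSet {q : X × X | G.Adj q.1 q.2})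
    (hs : ∀ x y, G.Adj x y → ∃ i, y = s i x)
    {B : Set X} (hB : MeasurableSet B) (hB0 : 0 < μ B) {q : ℕ → X → ℝ≥0∞}
    (hq : ∀ i, Measurable (q i)) (hq1 : ∀ x ∈ B, ∑' i, q i x = 1) {r : ℕ → X → ℝ≥0∞}
    (hr : ∀ i, ∀ x ∈ B, q i x ≤ r i x) (hr' : ∀ i, ∀ x ∈ B, ∀ y ∈ B, G.Adj x y → q i y ≤ r i x)
    {δ ε : ℝ≥0∞} (hδ : δ < ε) (hε : ε ≠ ⊤)
    (hr1 : ∀ x ∈ B, ∑' i, r i x ≤ 1 + δ) :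
    ∃ (i : ℕ) (t : ℝ), 0 < t ∧
      μ (outerBoundary G B {x | x ∈ B ∧ ENNReal.ofReal t < q i x}) <
        ε * μ {x | x ∈ B ∧ ENNReal.ofReal t < q i x} := by
  -- `Q i x` is the supremum of `q i` over `x` and its neighbours in `B`. Its superlevel sets
  -- contain those of `q i` together with their outer boundaries, and unlike `r i` it is known to be
  -- measurable.
  set Q : ℕ → X → ℝ≥0∞ := fun i x => q i x ⊔ ⨆ j, if s j x ∈ B ∧ G.Adj x (s j x) then
    q i (s j x) else 0 with hQ
  have hQm : ∀ i, Measurable (Q i) := by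
    intro i
    refine (hq i).sup (Measurable.iSup fun j => Measurable.ite ?_ ((hq i).comp (hm j))
      measurable_const)
    exact (hB.preimage (hm j)).inter (hG.preimage (measurable_id.prodMk (hm j)))
  have hQr : ∀ i, ∀ x ∈ B, Q i x ≤ r i x := by
    intro i x hx
    refine sup_le (hr i x hx) (iSup_le fun j => ?_)
    split_ifs with h
    · exact hr' i x hx _ h.1 h.2
    · exact zero_le
  by_contra! hcon
  have hae : ∀ᵐ x ∂μ.restrict B, x ∈ B := ae_restrict_mem hB
  have hfin : ∀ i, ∀ᵐ x ∂μ.restrict B, Q i x ≠ ⊤ := by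
    intro i
    refine hae.mono fun x hx => ne_top_of_le_ne_top ?_
      (((hQr i x hx).trans (ENNReal.le_tsum i)).trans (hr1 x hx))
    exact ENNReal.add_ne_top.2 ⟨ENNReal.one_ne_top, hδ.ne_top⟩
  have hfin' : ∀ i, ∀ᵐ x ∂μ.restrict B, q i x ≠ ⊤ := fun i =>
    (hfin i).mono fun x hx => ne_top_of_le_ne_top hx le_sup_left
  -- If every superlevel set fails, adding the disjoint outer boundary enlarges each of them by a
  -- factor at least `1 + ε`.
  have hlev : ∀ i, ∀ t : ℝ, 0 < t →
      (1 + ε) * μ.restrict B {x | ENNReal.ofReal t < q i x} ≤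
        μ.restrict B {x | ENNReal.ofReal t < Q i x} := by
    intro i t ht
    have hA : {x | x ∈ B ∧ ENNReal.ofReal t < q i x} = {x | ENNReal.ofReal t < q i x} ∩ B := by
      ext x; exact and_comm
    have hm1 : MeasurableSet {x | ENNReal.ofReal t < q i x} :=
      measurableSet_lt measurable_const (hq i)
    have hm2 : MeasurableSet {x | ENNReal.ofReal t < Q i x} :=
      measurableSet_lt measurable_const (hQm i)
    rw [Measure.restrict_apply hm1, Measure.restrict_apply hm2, ← hA, add_mul, one_mul]
    refine (add_le_add_right (hcon i t ht) _).trans ?_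
    rw [← measure_union' ?_ (hA ▸ hm1.inter hB)]
    · refine measure_mono ?_
      rintro x (hx | ⟨⟨hxB, -⟩, y, hy, hxy⟩)
      · exact ⟨lt_of_lt_of_le hx.2 le_sup_left, hx.1⟩
      · refine ⟨?_, hxB⟩
        obtain ⟨j, rfl⟩ := hs x y hxy
        refine lt_of_lt_of_le hy.2 (le_sup_of_le_right (le_iSup_of_le j ?_))
        rw [if_pos ⟨hy.1, hxy⟩]
    · exact Set.disjoint_left.2 fun x hx hx' => hx'.1.2 hx
  have hint : ∀ i, (1 + ε) * ∫⁻ x in B, q i x ∂μ ≤ ∫⁻ x in B, Q i x ∂μ := by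
    intro i
    rw [lintegral_eq_lintegral_measure_ofReal_lt (hq i) (hfin' i),
      lintegral_eq_lintegral_measure_ofReal_lt (hQm i) (hfin i)]
    rw [← lintegral_const_mul']
    · exact setLIntegral_mono' measurableSet_Ioi fun t ht => hlev i t ht
    · exact ENNReal.add_ne_top.2 ⟨ENNReal.one_ne_top, hε⟩
  -- Integrating over `t` and summing over `i` turns the level estimates into a contradiction with
  -- `δ < ε`.
  have hsum : (1 + ε) * μ B ≤ (1 + δ) * μ B := by
    calc (1 + ε) * μ B = (1 + ε) * ∫⁻ x in B, ∑' i, q i x ∂μ := by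
          rw [setLIntegral_congr_fun hB (g := 1) hq1]; simp
      _ = ∑' i, (1 + ε) * ∫⁻ x in B, q i x ∂μ := by
          rw [lintegral_tsum fun i => (hq i).aemeasurable, ENNReal.tsum_mul_left]
      _ ≤ ∑' i, ∫⁻ x in B, Q i x ∂μ := ENNReal.tsum_le_tsum hint
      _ = ∫⁻ x in B, ∑' i, Q i x ∂μ := (lintegral_tsum fun i => (hQm i).aemeasurable).symm
      _ ≤ ∫⁻ x in B, (1 + δ) ∂μ := setLIntegral_mono' hB fun x hx =>
          (ENNReal.tsum_le_tsum fun i => hQr i x hx).trans (hr1 x hx)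
      _ = _ := by simp
  have h2 := (ENNReal.mul_le_mul_iff_left hB0.ne' (measure_ne_top μ B)).1 hsum
  exact absurd ((ENNReal.add_le_add_iff_left ENNReal.one_ne_top).1 h2) (not_le.2 hδ)

end Local

/-! ### Uniform amenability implies local, then uniform, hyperfiniteness. -/

section AmenableToHyperfinite

variable {X : Type u} [MeasurableSpace X] {G : SimpleGraph X} {μ : Measure X}

theorem measurableSet_outerBoundary {s : ℕ → X → X}
    (hm : ∀ i, Measurable (s i)) (hG : MeasurableSet {q : X × X | G.Adj q.1 q.2})
    (hs : ∀ x y, G.Adj x y → ∃ i, y = s i x) {A B : Set X} (hA : MeasurableSet A)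
    (hB : MeasurableSet B) : MeasurableSet (outerBoundary G B A) := by
  have : outerBoundary G B A = (B \ A) ∩ ⋃ j, (s j ⁻¹' A ∩ {x | G.Adj x (s j x)}) := by
    ext x
    simp only [outerBoundary, Set.mem_ofPred_eq, Set.mem_inter_iff, Set.mem_iUnion,
      Set.mem_preimage]
    refine and_congr_right fun _ => ⟨?_, fun ⟨j, h1, h2⟩ => ⟨_, h1, h2⟩⟩
    rintro ⟨y, hy, hxy⟩
    obtain ⟨j, rfl⟩ := hs x y hxy
    exact ⟨j, hy, hxy⟩
  rw [this]
  exact (hB.diff hA).inter (MeasurableSet.iUnion fun j => (hA.preimage (hm j)).inter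
    (hG.preimage (measurable_id.prodMk (hm j))))

theorem IsUniformlyAmenable.isUniformlyLocallyHyperfinite [StandardBorelSpace X]
    [IsProbabilityMeasure μ] (hG : IsMeasuredGraph G μ) (hd : BoundedDegree G)
    (h : IsUniformlyAmenable G μ) : IsUniformlyLocallyHyperfinite G μ := by
  classical
  intro ε hε
  obtain ⟨R, -, Y, hY, hYinv, hY1, p, hp, hpY⟩ := h (ε / 2) (half_pos hε)
  obtain ⟨s, hm, -, hs⟩ := hG.exists_maps
  have hs' : ∀ x y, G.Adj x y → ∃ i, y = s i x := fun x y h => ((hs x y).1 h).2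
  obtain ⟨K, hK⟩ := hd.exists_card_graphBall_le R
  -- Radius `2R` makes colours injective on every `R`-ball; the extra 1 compares the balls of two
  -- adjacent points.
  obtain ⟨c, hc, hcol⟩ := exists_measurable_coloring hd hm hs (2 * R + 1)
  refine ⟨K + 1, by omega, fun B hB hB0 => ?_⟩
  set P : X → X → ℝ≥0∞ := fun x z => ENNReal.ofReal (p x z) with hP
  have hP0 : ∀ x ∈ Y, ∀ z, P x z ≠ 0 → z ∈ graphBall G x R := fun x hx z hz =>
    (hpY x hx).2.2.1 fun h0 => hz (by simp [hP, h0])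
  have huniq : ∀ x z z', z ∈ graphBall G x R → z' ∈ graphBall G x R → c z = c z' → z = z' := by
    intro x z z' hz hz' hcz
    by_contra hne
    obtain ⟨w, hw⟩ := exists_walk_of_mem_graphBall hz
    obtain ⟨w', hw'⟩ := exists_walk_of_mem_graphBall hz'
    refine hcol z z' (mem_graphBall_of_walk (w.reverse.append w') ?_) hne hcz
    rw [SimpleGraph.Walk.length_append, SimpleGraph.Walk.length_reverse]
    omega
  -- For `x ∈ Y` this is the mass of `p x` at colour `i`; at most one point of the ball has that
  -- colour, so a supremum over words equals the sum and is visibly measurable.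
  set q : ℕ → X → ℝ≥0∞ := fun i x => ⨆ l : List ℕ,
    if c (wordMap s l x) = i then P x (wordMap s l x) else 0 with hq
  have hqm : ∀ i, Measurable (q i) := by
    intro i
    refine Measurable.iSup fun l => Measurable.ite ?_ ?_ measurable_const
    · exact (measurableSet_singleton i).preimage (hc.comp (measurable_wordMap hm l))
    · exact (hp.comp (measurable_id.prodMk (measurable_wordMap hm l))).ennreal_ofReal
  have hqsum : ∀ x ∈ Y, ∀ i, q i x = ∑' z, if c z = i then P x z else 0 := by
    intro x hx i
    refine le_antisymm (iSup_le fun l => ENNReal.le_tsum (f := fun z => if c z = i then P x z else 0)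
      _) ?_
    by_cases hz : ∃ z, c z = i ∧ P x z ≠ 0
    · obtain ⟨z, hzi, hz⟩ := hz
      rw [tsum_eq_single z]
      · obtain ⟨w, hw⟩ := exists_walk_of_mem_graphBall (hP0 x hx z hz)
        obtain ⟨l, -, rfl⟩ := exists_wordMap_eq_of_walk hs' w
        exact le_iSup (fun l : List ℕ => if c (wordMap s l x) = i then P x (wordMap s l x) else 0) l
      · intro z' hne
        split_ifs with h'
        · by_contra h0
          exact hne (huniq x z' z (hP0 x hx _ h0) (hP0 x hx _ hz) (h'.trans hzi.symm))
        · rfl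
    · push Not at hz
      rw [ENNReal.tsum_eq_zero.2 fun z => ?_]
      · exact zero_le
      · split_ifs with h'
        · exact hz z h'
        · rfl
  have hcomm : ∀ f : X → ℝ≥0∞, ∑' i, ∑' z, (if c z = i then f z else 0) = ∑' z, f z := by
    intro f
    rw [ENNReal.tsum_comm]
    refine tsum_congr fun z => ?_
    rw [tsum_eq_single (c z) (fun i hi => if_neg (Ne.symm hi)), if_pos rfl]
  have hP1 : ∀ x ∈ Y, ∑' z, P x z = 1 := by
    intro x hx
    rw [← ENNReal.ofReal_tsum_of_nonneg (hpY x hx).1 (hpY x hx).2.1.summable,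
      (hpY x hx).2.1.tsum_eq, ENNReal.ofReal_one]
  -- `p x z + D x z` dominates `p y z` for every neighbour `y` at once, and `D x` has total mass at
  -- most `ε / 2`.
  set D : X → X → ℝ≥0∞ := fun x z => ∑' y : G.neighborSet x, ENNReal.ofReal |p x z - p y z| with hD
  have hDsum : ∀ x ∈ Y, ∑' z, D x z ≤ ENNReal.ofReal (ε / 2) := by
    intro x hx
    have hfin : Finite (G.neighborSet x) := by
      obtain ⟨d, hd⟩ := hd
      exact Set.finite_of_encard_le_coe (hd x)
    have hsm : ∀ y : G.neighborSet x, Summable fun z => |p x z - p y z| := fun y =>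
      ((hpY x hx).2.1.summable.sub (hpY y (hYinv.mem_of_adj hx y.2)).2.1.summable).abs
    rw [ENNReal.tsum_comm]
    calc ∑' y : G.neighborSet x, ∑' z, ENNReal.ofReal |p x z - p y z|
        = ∑' y : G.neighborSet x, ENNReal.ofReal (∑' z, |p x z - p y z|) :=
          tsum_congr fun y => (ENNReal.ofReal_tsum_of_nonneg (fun _ => abs_nonneg _) (hsm y)).symm
      _ = ENNReal.ofReal (∑' y : G.neighborSet x, ∑' z, |p x z - p y z|) :=
          (ENNReal.ofReal_tsum_of_nonneg (fun y => tsum_nonneg fun _ => abs_nonneg _)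
            (Summable.of_finite)).symm
      _ ≤ _ := ENNReal.ofReal_le_ofReal (hpY x hx).2.2.2
  have hBY : μ (B ∩ Y) = μ B := by
    have h0 : μ Yᶜ = 0 := (prob_compl_eq_zero_iff hY).2 hY1
    exact measure_inter_conull h0
  obtain ⟨i, t, ht, hlt⟩ := exists_superlevel_outerBoundary_lt hm hG.1 hs' (hB.inter hY)
    (hBY ▸ hB0) hqm (r := fun i x => ∑' z, if c z = i then P x z + D x z else 0)
    (δ := ENNReal.ofReal (ε / 2)) (ε := ENNReal.ofReal ε)
    (fun x hx => by
      rw [← hP1 x hx.2, ← hcomm]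
      exact tsum_congr fun i => hqsum x hx.2 i)
    (fun i x hx => by
      rw [hqsum x hx.2]
      refine ENNReal.tsum_le_tsum fun z => ?_
      split_ifs
      · exact le_self_add
      · exact le_rfl)
    (fun i x hx y hy hxy => by
      rw [hqsum y hy.2]
      refine ENNReal.tsum_le_tsum fun z => ?_
      split_ifs
      · have h1 : ENNReal.ofReal |p x z - p y z| ≤ D x z :=
          ENNReal.le_tsum (f := fun y : G.neighborSet x => ENNReal.ofReal |p x z - p y z|)
            (⟨y, hxy⟩ : G.neighborSet x)
        refine le_trans ?_ (add_le_add_right h1 _)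
        rw [← ENNReal.ofReal_add ((hpY x hx.2).1 z) (abs_nonneg _)]
        refine ENNReal.ofReal_le_ofReal ?_
        linarith [neg_abs_le (p x z - p y z)]
      · exact le_rfl)
    ((ENNReal.ofReal_lt_ofReal_iff hε).2 (half_lt_self hε)) ENNReal.ofReal_ne_top
    (fun x hx => by
      rw [hcomm, ENNReal.tsum_add, hP1 x hx.2]
      exact add_le_add_right (hDsum x hx.2) _)
  set A := {x | x ∈ B ∩ Y ∧ ENNReal.ofReal t < q i x} with hA
  have hAm : MeasurableSet A :=
    (hB.inter hY).inter (measurableSet_lt measurable_const (hqm i))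
  have hwit : ∀ x ∈ A, ∃ z, c z = i ∧ z ∈ graphBall G x R := by
    intro x hx
    obtain ⟨l, hl⟩ := lt_iSup_iff.1 hx.2
    split_ifs at hl with hci
    · exact ⟨_, hci, hP0 x hx.1.2 _ (ne_bot_of_gt hl)⟩
    · exact absurd hl (not_lt.2 zero_le)
  refine ⟨A, hAm, fun x hx => hx.1.1, ?_, ?_, ?_⟩
  · refine pos_iff_ne_zero.2 fun h0 => ?_
    rw [h0, mul_zero] at hlt
    exact absurd hlt (not_lt.2 zero_le)
  · refine lt_of_le_of_lt (measure_mono ?_) hlt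
    rintro x ⟨⟨hxB, hxA⟩, y, hy, hxy⟩
    exact ⟨⟨⟨hxB, hYinv.mem_of_adj hy.1.2 hxy.symm⟩, hxA⟩, y, hy, hxy⟩
  · have : Nonempty X := (nonempty_of_measure_ne_zero hB0.ne').to_subtype.map Subtype.val
    -- `Z x` is the colour-`i` point near `x`. Adjacent points of `A` have the same `Z`, so a
    -- component lies in an `R`-ball around it.
    choose! Z hZ using hwit
    refine componentsAtMost_of_label Z ?_ ?_
    · intro x hx y hy hxy
      by_contra hne
      obtain ⟨w, hw⟩ := exists_walk_of_mem_graphBall (hZ x hx).2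
      obtain ⟨w', hw'⟩ := exists_walk_of_mem_graphBall (hZ y hy).2
      refine hcol _ _ (mem_graphBall_of_walk (w.reverse.append (.cons hxy w')) ?_) hne
        ((hZ x hx).1.trans (hZ y hy).1.symm)
      rw [SimpleGraph.Walk.length_append, SimpleGraph.Walk.length_reverse,
        SimpleGraph.Walk.length_cons]
      omega
    · intro x hx
      obtain ⟨F, hF, hF'⟩ := hK (Z x)
      have hsub : {y | y ∈ A ∧ Z y = Z x} ⊆ (F : Set X) := by
        rintro y ⟨hy, hyx⟩
        refine hF' ?_
        obtain ⟨w, hw⟩ := exists_walk_of_mem_graphBall (hZ y hy).2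
        rw [← hyx]
        exact mem_graphBall_of_walk w.reverse (by rwa [SimpleGraph.Walk.length_reverse])
      refine (Set.encard_le_encard hsub).trans ?_
      rw [Set.encard_coe_eq_coe_finsetCard]
      exact_mod_cast hF.trans (Nat.le_succ K)

/-- Greedy exhaustion: repeatedly remove a nearly largest good set together with its outer boundary.
The good sets are disjoint, so the boundaries have total measure at most `ε * μ A`; a non-null
remainder would contain a good set too large to have been passed over. -/
theorem IsLocallyHyperfiniteWith.exists_separating [IsFiniteMeasure μ]
    (hG : IsMeasuredGraph G μ) {ε : ℝ} {K : ℕ} (h : IsLocallyHyperfiniteWith G μ ε K)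
    {A : Set X} (hA : MeasurableSet A) :
    ∃ T : Set X, MeasurableSet T ∧ T ⊆ A ∧ μ T ≤ ENNReal.ofReal ε * μ A ∧
      ComponentsAtMost G (A \ T) K := by
  classical
  obtain ⟨s, hm, -, hs⟩ := hG.exists_maps
  have hs' : ∀ x y, G.Adj x y → ∃ i, y = s i x := fun x y h => ((hs x y).1 h).2
  -- The boundary inequality is weak here, so that `∅` is good and a choice exists at every stage.
  let Good : Set X → Set X → Prop := fun B A => MeasurableSet A ∧ A ⊆ B ∧
    μ (outerBoundary G B A) ≤ ENNReal.ofReal ε * μ A ∧ ComponentsAtMost G A K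
  -- The supremum of the measures need not be attained; half of it suffices.
  have hbest : ∀ B, ∃ A, Good B A ∧ ∀ A', Good B A' → μ A' ≤ 2 * μ A := by
    intro B
    have hempty : Good B ∅ := by
      refine ⟨MeasurableSet.empty, Set.empty_subset _, ?_, ?_⟩
      · simp [outerBoundary]
      · exact componentsAtMost_iff.2 fun x hx => absurd hx (Set.notMem_empty x)
    set v := ⨆ A' : {A' // Good B A'}, μ A'.1 with hv
    have hvle : ∀ A', Good B A' → μ A' ≤ v := fun A' hA' =>
      le_iSup (fun A' : {A' // Good B A'} => μ A'.1) ⟨A', hA'⟩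
    have hvtop : v ≠ ⊤ := ne_top_of_le_ne_top (measure_ne_top μ Set.univ)
      (iSup_le fun A' => measure_mono (Set.subset_univ _))
    by_cases hv0 : v = 0
    · exact ⟨∅, hempty, fun A' hA' => by simpa [hv0] using hvle A' hA'⟩
    · obtain ⟨⟨A, hA⟩, hlt⟩ := lt_iSup_iff.1 (ENNReal.half_lt_self hv0 hvtop)
      refine ⟨A, hA, fun A' hA' => (hvle A' hA').trans ?_⟩
      rw [mul_comm]
      exact (ENNReal.div_le_iff_le_mul (by simp) (by simp)).1 hlt.le
  choose F hF hFbest using hbest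
  let B : ℕ → Set X := fun n => Nat.rec A (fun _ B => B \ (F B ∪ outerBoundary G B (F B))) n
  have hBsucc : ∀ n, B (n + 1) = B n \ (F (B n) ∪ outerBoundary G (B n) (F (B n))) := fun _ => rfl
  have hFm : ∀ n, MeasurableSet (F (B n)) := fun n => (hF _).1
  have hBm : ∀ n, MeasurableSet (B n) := by
    intro n
    induction n with
    | zero => exact hA
    | succ n ih =>
      exact ih.diff ((hFm n).union (measurableSet_outerBoundary hm hG.1 hs' (hFm n) ih))
  have hanti : Antitone B := antitone_nat_of_succ_le fun n => by
    rw [hBsucc]; exact Set.sdiff_subset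
  have hFB : ∀ n, F (B n) ⊆ B n := fun n => (hF _).2.1
  have hFlt : ∀ n m, n < m → Disjoint (F (B n)) (B m) := by
    intro n m hnm
    refine Set.disjoint_left.2 fun x hx hx' => ?_
    have : x ∈ B (n + 1) := hanti hnm hx'
    rw [hBsucc] at this
    exact this.2 (Or.inl hx)
  have hdisj : Pairwise (Function.onFun Disjoint fun n => F (B n)) := by
    intro n m hnm
    rcases lt_or_gt_of_ne hnm with h | h
    · exact (hFlt n m h).mono_right (hFB m)
    · exact ((hFlt m n h).mono_right (hFB n)).symm
  have hsum : ∑' n, μ (F (B n)) ≤ μ A := by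
    rw [← measure_iUnion hdisj hFm]
    exact measure_mono (Set.iUnion_subset fun n => (hFB n).trans (hanti (Nat.zero_le n)))
  set D := ⋂ n, B n with hD
  have hDm : MeasurableSet D := MeasurableSet.iInter hBm
  have hD0 : μ D = 0 := by
    by_contra hD0
    obtain ⟨A', hA', hA'D, hA'0, hlt, hcomp⟩ := h D hDm (pos_iff_ne_zero.2 hD0)
    -- The boundaries in `B n` decrease to the boundary in `D`, so the strict inequality for `D`
    -- already holds at a late stage. There `A'` is good, while the chosen sets have measure tending
    -- to 0.
    have hDb : outerBoundary G D A' = ⋂ n, outerBoundary G (B n) A' := by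
      ext x
      simp only [outerBoundary, Set.mem_ofPred_eq, Set.mem_iInter, hD, Set.mem_sdiff]
      exact ⟨fun h n => ⟨⟨h.1.1 n, h.1.2⟩, h.2⟩, fun h => ⟨⟨fun n => (h n).1.1, (h 0).1.2⟩, (h 0).2⟩⟩
    have hlim : Tendsto (fun n => μ (outerBoundary G (B n) A')) atTop
        (𝓝 (μ (outerBoundary G D A'))) := by
      rw [hDb]
      refine tendsto_measure_iInter_atTop (fun n =>
        (measurableSet_outerBoundary hm hG.1 hs' hA' (hBm n)).nullMeasurableSet) ?_
        ⟨0, measure_ne_top μ _⟩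
      exact fun n m hnm x hx => ⟨⟨hanti hnm hx.1.1, hx.1.2⟩, hx.2⟩
    have hev := hlim.eventually_lt_const hlt
    have h0 : Tendsto (fun n => 2 * μ (F (B n))) atTop (𝓝 0) := by
      have := ENNReal.tendsto_atTop_zero_of_tsum_ne_top
        (ne_top_of_le_ne_top (measure_ne_top μ A) hsum)
      simpa using ENNReal.Tendsto.const_mul (a := 2) this (Or.inr (by simp))
    obtain ⟨n, hn1, hn2⟩ := (hev.and (h0.eventually_lt_const hA'0)).exists
    refine absurd (hFbest (B n) A' ⟨hA', hA'D.trans (Set.iInter_subset _ n), hn1.le, hcomp⟩)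
      (not_le.2 hn2)
  refine ⟨D ∪ ⋃ n, outerBoundary G (B n) (F (B n)), hDm.union (MeasurableSet.iUnion fun n =>
    measurableSet_outerBoundary hm hG.1 hs' (hFm n) (hBm n)), ?_, ?_, ?_⟩
  · refine Set.union_subset (Set.iInter_subset B 0) (Set.iUnion_subset fun n x hx => ?_)
    exact hanti (Nat.zero_le n) hx.1.1
  · calc μ (D ∪ ⋃ n, outerBoundary G (B n) (F (B n)))
        ≤ μ D + ∑' n, μ (outerBoundary G (B n) (F (B n))) :=
          (measure_union_le _ _).trans (add_le_add_right (measure_iUnion_le _) _)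
      _ ≤ ∑' n, ENNReal.ofReal ε * μ (F (B n)) := by
          rw [hD0, zero_add]
          exact ENNReal.tsum_le_tsum fun n => (hF _).2.2.1
      _ ≤ _ := by
          rw [ENNReal.tsum_mul_left]
          gcongr
  · set T := D ∪ ⋃ n, outerBoundary G (B n) (F (B n)) with hT
    have hcov : ∀ x ∈ A \ T, ∃ n, x ∈ F (B n) := by
      rintro x ⟨hxA, hxT⟩
      have hxD : ∃ n, x ∉ B n := by
        by_contra! hcon
        exact hxT (Or.inl (Set.mem_iInter.2 hcon))
      obtain ⟨k, h1, h2⟩ : ∃ k, x ∈ B k ∧ x ∉ B (k + 1) := by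
        by_contra! hcon
        obtain ⟨n, hn⟩ := hxD
        exact hn (Nat.rec hxA (fun n ih => hcon n ih) n)
      rw [hBsucc] at h2
      have h3 : x ∈ F (B k) ∪ outerBoundary G (B k) (F (B k)) := by
        by_contra h3
        exact h2 ⟨h1, h3⟩
      rcases h3 with h3 | h3
      · exact ⟨k, h3⟩
      · exact absurd (Or.inr (Set.mem_iUnion.2 ⟨k, h3⟩)) hxT
    choose! f hf using hcov
    -- If `y` were removed later than its neighbour `x`, it would lie in the outer boundary taken at
    -- the stage of `x`, hence in `T`.
    have hno : ∀ x ∈ A \ T, ∀ y ∈ A \ T, G.Adj x y → ¬ f x < f y := by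
      intro x hx y hy hxy hlt
      refine hy.2 (Or.inr (Set.mem_iUnion.2 ⟨f x, ⟨hanti hlt.le (hFB _ (hf y hy)), ?_⟩, x, hf x hx,
        hxy.symm⟩))
      exact fun hy' => Set.disjoint_left.1 (hFlt _ _ hlt) hy' (hFB _ (hf y hy))
    refine componentsAtMost_of_label_of_pieces f ?_ ?_
    · intro x hx y hy hxy
      exact le_antisymm (not_lt.1 (hno y hy x hx hxy.symm)) (not_lt.1 (hno x hx y hy hxy))
    · intro x hx
      refine ⟨F (B (f x)), ?_, (hF _).2.2.2⟩
      rintro y ⟨hy, hyx⟩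
      exact hyx ▸ hf y hy

theorem IsUniformlyLocallyHyperfinite.isUniformlyHyperfinite [IsFiniteMeasure μ]
    (hG : IsMeasuredGraph G μ) (h : IsUniformlyLocallyHyperfinite G μ) :
    IsUniformlyHyperfinite G μ := by
  intro ε hε
  obtain ⟨K, hK, h⟩ := h (ε / 2) (half_pos hε)
  refine ⟨K, hK, fun A hA hA0 => ?_⟩
  obtain ⟨T, hT, hTA, hμ, hcomp⟩ := h.exists_separating hG hA
  refine ⟨T, hT, hTA, ?_, hcomp⟩
  refine lt_of_le_of_lt (ENNReal.div_le_of_le_mul hμ) ?_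
  exact (ENNReal.ofReal_lt_ofReal_iff hε).2 (half_lt_self hε)

end AmenableToHyperfinite

/-! ### Uniform hyperfiniteness implies weighted hyperfiniteness. -/

section Weighted

variable {X : Type u} [MeasurableSpace X] {G : SimpleGraph X} {μ : Measure X}

/-- Between two different blocks of levels lies a deleted level congruent to `s`, so the levels
differ by at least 2. -/
theorem add_two_le_of_ediv_lt_ediv {a b s L : ℤ} (hs : 0 ≤ s) (hsL : s < L) (ha : a % L ≠ s)
    (hb : b % L ≠ s) (h : (a - s) / L < (b - s) / L) : a + 2 ≤ b := by
  have hL : 0 < L := hs.trans_lt hsL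
  have key : ∀ c : ℤ, c % L ≠ s → 1 ≤ (c - s) % L := by
    intro c hc
    by_contra! hlt
    have h0 : (c - s) % L = 0 := le_antisymm (by omega) (Int.emod_nonneg _ hL.ne')
    apply hc
    have h2 : c % L = s % L := (Int.modEq_of_dvd (Int.dvd_of_emod_eq_zero h0)).symm
    rw [h2, Int.emod_eq_of_lt hs hsL]
  have h1 := key a ha
  have h2 := key b hb
  have h3 := Int.emod_add_mul_ediv (a - s) L
  have h4 := Int.emod_add_mul_ediv (b - s) L
  have h5 := Int.emod_lt_of_pos (a - s) hL
  have h6 : L * ((a - s) / L + 1) ≤ L * ((b - s) / L) := by gcongr; omega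
  rw [mul_add, mul_one] at h6
  omega

/-- Three deletions cost a fraction `ε` of the weight each: the lightest of `L` residue classes of
levels (`1 / L ≤ ε`), the points with a neighbour at least `M` times heavier (`m * C / M ≤ ε`), and
separators inside the blocks. Weights in a block differ by a factor at most `M ^ L`, whence the
precision `ε / M ^ L`. Points of weight zero are deleted for free. -/
theorem exists_separator_withDensity_le [IsFiniteMeasure μ] {m : ℕ} {s : Fin m → X → X}
    {C : ℝ≥0} (hm : ∀ i, Measurable (s i)) (hC : ∀ i, μ.map (s i) ≤ C • μ)
    (hs : ∀ x y, G.Adj x y → ∃ i, y = s i x) {ε : ℝ} (hε : 0 < ε) {L M K : ℕ} (hL : 1 ≤ L * ε)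
    (hM : 2 ≤ M) (hMC : m * C ≤ ε * M)
    (hK : ∀ A : Set X, MeasurableSet A → 0 < μ A → IsHyperfiniteOn G μ A (ε / M ^ L) K)
    {W : X → ℝ} (hW : Measurable W) (hW0 : ∀ x, 0 ≤ W x) :
    ∃ A : Set X, IsSeparator G K A ∧ ∫⁻ x in A, ENNReal.ofReal (W x) ∂μ ≤
      ENNReal.ofReal (3 * ε) * ∫⁻ x, ENNReal.ofReal (W x) ∂μ := by
  classical
  have hL0 : 0 < L := by
    rcases Nat.eq_zero_or_pos L with h | h
    · simp [h] at hL; linarith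
    · exact h
  have hM0 : (0 : ℝ) < M := by positivity
  have hM1 : (1 : ℝ) < M := by exact_mod_cast (by omega : 1 < M)
  set ν := μ.withDensity fun x => ENNReal.ofReal (W x) with hν
  have hf : Measurable fun x => ENNReal.ofReal (W x) := hW.ennreal_ofReal
  have hνA : ∀ A, MeasurableSet A → ∫⁻ x in A, ENNReal.ofReal (W x) ∂μ = ν A := fun A hA =>
    (withDensity_apply _ hA).symm
  have hνu : ∫⁻ x, ENNReal.ofReal (W x) ∂μ = ν Set.univ := by
    rw [← hνA _ MeasurableSet.univ, Measure.restrict_univ]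
  set lev : X → ℤ := fun x => Int.log M (W x) with hlev
  have hlevm : Measurable lev := by
    have : lev = fun x => ⌊Real.logb M (W x)⌋ := by
      ext x
      exact (Real.floor_logb_natCast (hW0 x)).symm
    rw [this]
    exact ((Real.measurable_log.comp hW).div_const _).floor
  have hlev1 : ∀ x, 0 < W x → (M : ℝ) ^ lev x ≤ W x := fun x hx =>
    Int.zpow_log_le_self (by omega) hx
  have hlev2 : ∀ x, W x < (M : ℝ) ^ (lev x + 1) := fun x => Int.lt_zpow_succ_log_self (by omega) _
  have hpos : MeasurableSet {x | 0 < W x} := measurableSet_lt measurable_const hW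
  -- the level classes modulo `L`
  set E : ℕ → Set X := fun r => {x | lev x % L = r} with hE
  have hEm : ∀ r, MeasurableSet (E r) := fun r =>
    (MeasurableSet.of_discrete (s := {k : ℤ | k % L = r})).preimage hlevm
  obtain ⟨r, hr, hrE⟩ : ∃ r ∈ Finset.range L, ν (E r) ≤ ν Set.univ / L := by
    by_contra! hcon
    have h1 := ENNReal.sum_lt_sum_of_nonempty (by simpa using hL0.ne') hcon
    rw [Finset.sum_const, Finset.card_range, nsmul_eq_mul, ENNReal.mul_div_cancel (by simp [hL0.ne'])
      (by simp), ← measure_biUnion_finset ?_ (fun r _ => hEm r)] at h1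
    · exact absurd (measure_mono (Set.subset_univ _)) (not_le.2 h1)
    · intro a _ b _ hab
      refine Set.disjoint_left.2 fun x hx hx' => hab ?_
      have h1 : lev x % L = a := hx
      have h2 : lev x % L = b := hx'
      exact_mod_cast h1.symm.trans h2
  have hrL : (r : ℤ) < L := by exact_mod_cast Finset.mem_range.1 hr
  have hEle : ν (E r) ≤ ENNReal.ofReal ε * ν Set.univ := by
    refine hrE.trans (ENNReal.div_le_of_le_mul ?_)
    have h1 : (1 : ℝ≥0∞) ≤ ENNReal.ofReal ε * L := by
      rw [← ENNReal.ofReal_natCast, ← ENNReal.ofReal_mul hε.le, ← ENNReal.ofReal_one]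
      exact ENNReal.ofReal_le_ofReal (by linarith)
    calc ν Set.univ = 1 * ν Set.univ := (one_mul _).symm
      _ ≤ ENNReal.ofReal ε * L * ν Set.univ := by gcongr
      _ = _ := by ring
  -- points having a neighbour of much larger weight
  set D : Fin m → Set X := fun i => {x | M * W x ≤ W (s i x)} with hD
  have hDm : ∀ i, MeasurableSet (D i) := fun i =>
    measurableSet_le (hW.const_mul _) (hW.comp (hm i))
  -- Markov's inequality for `W ∘ s i`, whose integral is at most `C` times that of `W` by the bound
  -- on the push-forward.
  have hDi : ∀ i, M * ν (D i) ≤ C * ν Set.univ := by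
    intro i
    calc (M : ℝ≥0∞) * ν (D i) = ∫⁻ x in D i, M * ENNReal.ofReal (W x) ∂μ := by
          rw [lintegral_const_mul _ hf, hνA _ (hDm i)]
      _ ≤ ∫⁻ x in D i, ENNReal.ofReal (W (s i x)) ∂μ := by
          refine setLIntegral_mono' (hDm i) fun x hx => ?_
          rw [← ENNReal.ofReal_natCast, ← ENNReal.ofReal_mul hM0.le]
          exact ENNReal.ofReal_le_ofReal hx
      _ ≤ ∫⁻ x, ENNReal.ofReal (W (s i x)) ∂μ := setLIntegral_le_lintegral _ _
      _ = ∫⁻ x, ENNReal.ofReal (W x) ∂(μ.map (s i)) := (lintegral_map hf (hm i)).symm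
      _ ≤ ∫⁻ x, ENNReal.ofReal (W x) ∂(C • μ) := lintegral_mono' (hC i) le_rfl
      _ = C * ν Set.univ := by rw [lintegral_smul_measure, hνu]; rfl
  have hDle : ν (⋃ i, D i) ≤ ENNReal.ofReal ε * ν Set.univ := by
    have h1 : M * ν (⋃ i, D i) ≤ M * (ENNReal.ofReal ε * ν Set.univ) := by
      calc (M : ℝ≥0∞) * ν (⋃ i, D i) ≤ M * ∑ i, ν (D i) := by
            gcongr
            exact (measure_iUnion_le _).trans (tsum_fintype _).le
        _ ≤ ∑ i : Fin m, C * ν Set.univ := by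
            rw [Finset.mul_sum]
            exact Finset.sum_le_sum fun i _ => hDi i
        _ = (m * C) * ν Set.univ := by simp [mul_assoc]
        _ ≤ (ENNReal.ofReal ε * M) * ν Set.univ := by
            refine mul_le_mul' ?_ le_rfl
            rw [← ENNReal.ofReal_natCast, ← ENNReal.ofReal_natCast, ← ENNReal.ofReal_coe_nnreal,
              ← ENNReal.ofReal_mul hε.le, ← ENNReal.ofReal_mul (by positivity)]
            exact ENNReal.ofReal_le_ofReal hMC
        _ = _ := by ring
    exact (ENNReal.mul_le_mul_iff_right (by simp; omega) (by simp)).1 h1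
  -- blocks of consecutive levels
  set U : ℤ → Set X := fun j => {x | 0 < W x ∧ lev x % L ≠ r ∧ (lev x - r) / L = j} with hU
  have hUm : ∀ j, MeasurableSet (U j) := fun j => hpos.inter
    ((MeasurableSet.of_discrete (s := {k : ℤ | k % L ≠ r ∧ (k - r) / L = j})).preimage hlevm)
  have hUb : ∀ j, ∀ x ∈ U j, (M : ℝ) ^ (r + L * j) ≤ W x ∧ W x ≤ (M : ℝ) ^ (r + L * j) * M ^ L := by
    rintro j x ⟨hx, -, hj⟩
    have h1 := Int.emod_add_mul_ediv (lev x - r) L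
    have h2 := Int.emod_nonneg (lev x - r) (b := L) (by omega)
    have h3 := Int.emod_lt_of_pos (lev x - r) (b := L) (by omega)
    rw [hj] at h1
    constructor
    · exact (zpow_le_zpow_right₀ hM1.le (by linarith)).trans (hlev1 x hx)
    · rw [← zpow_natCast (M : ℝ) L, ← zpow_add₀ hM0.ne']
      exact (hlev2 x).le.trans (zpow_le_zpow_right₀ hM1.le (by omega))
  have hT : ∀ j, ∃ T, MeasurableSet T ∧ T ⊆ U j ∧
      μ T ≤ ENNReal.ofReal (ε / M ^ L) * μ (U j) ∧ ComponentsAtMost G (U j \ T) K := by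
    intro j
    rcases eq_or_ne (μ (U j)) 0 with h0 | h0
    · refine ⟨U j, hUm j, subset_rfl, by simp [h0], ?_⟩
      rw [Set.sdiff_self]
      exact componentsAtMost_iff.2 fun x hx => absurd hx (Set.notMem_empty x)
    · obtain ⟨T, hT, hTU, hlt, hc⟩ := hK (U j) (hUm j) (pos_iff_ne_zero.2 h0)
      exact ⟨T, hT, hTU, (ENNReal.div_le_iff h0 (measure_ne_top _ _)).1 hlt.le, hc⟩
  choose T hTm hTU hTle hTc using hT
  have hTν : ∀ j, ν (T j) ≤ ENNReal.ofReal ε * ν (U j) := by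
    intro j
    set a : ℝ := (M : ℝ) ^ (r + L * j) with ha
    have ha0 : 0 ≤ a := by positivity
    calc ν (T j) = ∫⁻ x in T j, ENNReal.ofReal (W x) ∂μ := (hνA _ (hTm j)).symm
      _ ≤ ∫⁻ x in T j, ENNReal.ofReal (a * M ^ L) ∂μ := setLIntegral_mono' (hTm j) fun x hx =>
          ENNReal.ofReal_le_ofReal (hUb j x (hTU j hx)).2
      _ = ENNReal.ofReal (a * M ^ L) * μ (T j) := by simp
      _ ≤ ENNReal.ofReal (a * M ^ L) * (ENNReal.ofReal (ε / M ^ L) * μ (U j)) := by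
          gcongr; exact hTle j
      _ = ENNReal.ofReal ε * (ENNReal.ofReal a * μ (U j)) := by
          rw [← mul_assoc, ← mul_assoc, ← ENNReal.ofReal_mul (by positivity),
            ← ENNReal.ofReal_mul hε.le]
          congr 2
          field_simp
      _ = ENNReal.ofReal ε * ∫⁻ x in U j, ENNReal.ofReal a ∂μ := by simp
      _ ≤ ENNReal.ofReal ε * ∫⁻ x in U j, ENNReal.ofReal (W x) ∂μ := by
          gcongr _ * ?_
          exact setLIntegral_mono' (hUm j) fun x hx => ENNReal.ofReal_le_ofReal (hUb j x hx).1
      _ = _ := by rw [hνA _ (hUm j)]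
  have hTνu : ν (⋃ j, T j) ≤ ENNReal.ofReal ε * ν Set.univ := by
    calc ν (⋃ j, T j) ≤ ∑' j, ν (T j) := measure_iUnion_le _
      _ ≤ ∑' j, ENNReal.ofReal ε * ν (U j) := ENNReal.tsum_le_tsum hTν
      _ = ENNReal.ofReal ε * ν (⋃ j, U j) := by
          rw [ENNReal.tsum_mul_left, measure_iUnion _ hUm]
          intro a b hab
          exact Set.disjoint_left.2 fun x hx hx' => hab (hx.2.2.symm.trans hx'.2.2)
      _ ≤ _ := by gcongr; exact Set.subset_univ _
  have hZ : ν {x | 0 < W x}ᶜ = 0 := by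
    rw [← hνA _ hpos.compl, setLIntegral_congr_fun hpos.compl (g := 0)]
    · simp
    · intro x hx
      exact ENNReal.ofReal_eq_zero.2 (not_lt.1 hx)
  set A := {x | 0 < W x}ᶜ ∪ E r ∪ (⋃ i, D i) ∪ ⋃ j, T j with hA
  have hAm : MeasurableSet A := ((hpos.compl.union (hEm r)).union (MeasurableSet.iUnion hDm)).union
    (MeasurableSet.iUnion hTm)
  have hAc : ∀ x ∈ Aᶜ, 0 < W x ∧ lev x % L ≠ r ∧ (∀ i, W (s i x) < M * W x) ∧ ∀ j, x ∉ T j := by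
    intro x hx
    simp only [hA, Set.compl_union, Set.mem_inter_iff, compl_compl, Set.mem_compl_iff,
      Set.mem_iUnion, not_exists] at hx
    exact ⟨hx.1.1.1, hx.1.1.2, fun i => not_le.1 (hx.1.2 i), hx.2⟩
  refine ⟨A, ⟨hAm, ?_⟩, ?_⟩
  -- An edge to a higher block jumps at least two levels, so the weight grows by more than the
  -- factor `M`; a jump of one level would not force this. The lower endpoint is then in some `D i`.
  · have hno : ∀ x ∈ Aᶜ, ∀ y ∈ Aᶜ, G.Adj x y → ¬ (lev x - r) / L < (lev y - r) / L := by
      intro x hx y hy hxy hlt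
      obtain ⟨hx0, hx1, hx2, -⟩ := hAc x hx
      obtain ⟨hy0, hy1, -, -⟩ := hAc y hy
      have h2 := add_two_le_of_ediv_lt_ediv (by omega) hrL hx1 hy1 hlt
      obtain ⟨i, rfl⟩ := hs x y hxy
      have h3 : (M : ℝ) * W x < M ^ (lev x + 2) := by
        have : lev x + 2 = 1 + (lev x + 1) := by ring
        rw [this, zpow_add₀ hM0.ne', zpow_one]
        exact mul_lt_mul_of_pos_left (hlev2 x) hM0
      have h4 : (M : ℝ) ^ (lev x + 2) ≤ M ^ lev (s i x) := zpow_le_zpow_right₀ hM1.le h2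
      linarith [hx2 i, hlev1 _ hy0]
    refine componentsAtMost_of_label_of_pieces (fun x => (lev x - r) / L) ?_ ?_
    · intro x hx y hy hxy
      exact le_antisymm (not_lt.1 (hno y hy x hx hxy.symm)) (not_lt.1 (hno x hx y hy hxy))
    · intro x hx
      refine ⟨_, ?_, hTc ((lev x - r) / L)⟩
      rintro y ⟨hy, hyx⟩
      obtain ⟨hy0, hy1, -, hy3⟩ := hAc y hy
      exact ⟨⟨hy0, hy1, hyx⟩, hy3 _⟩
  · rw [hνA _ hAm, hνu]
    calc ν A ≤ ν {x | 0 < W x}ᶜ + ν (E r) + ν (⋃ i, D i) + ν (⋃ j, T j) :=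
          (measure_union_le _ _).trans (add_le_add_left ((measure_union_le _ _).trans
            (add_le_add_left (measure_union_le _ _) _)) _)
      _ ≤ 0 + ENNReal.ofReal ε * ν Set.univ + ENNReal.ofReal ε * ν Set.univ +
          ENNReal.ofReal ε * ν Set.univ := by
          gcongr
          exact hZ.le
      _ = _ := by
          rw [ENNReal.ofReal_mul (by norm_num)]
          simp
          ring

theorem IsUniformlyHyperfinite.isWeightedHyperfinite [IsFiniteMeasure μ]
    (hG : IsBoundedType G μ) (h : IsUniformlyHyperfinite G μ) : IsWeightedHyperfinite G μ := by
  intro ε hε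
  obtain ⟨m, s, C, hm, hC, hs⟩ := hG.exists_maps
  have hε3 : 0 < ε / 3 := by positivity
  obtain ⟨L, hL⟩ := exists_nat_ge (1 / (ε / 3))
  obtain ⟨M, hM⟩ := exists_nat_ge (max 2 (m * C / (ε / 3)))
  have hM2 : 2 ≤ M := by exact_mod_cast (le_max_left _ _).trans hM
  -- `L`, `M` and therefore `K` depend only on `ε` and the generators, not on the weight.
  obtain ⟨K, hK1, hK⟩ := h (ε / 3 / M ^ L) (by positivity)
  refine ⟨K, hK1, fun W hW0 hW => ?_⟩
  obtain ⟨W', hW'm, hWW'⟩ := hW.1.aemeasurable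
  set V : X → ℝ := fun x => max (W' x) 0 with hV
  have hWV : W =ᵐ[μ] V := hWW'.mono fun x hx => by simp [hV, ← hx, hW0 x]
  obtain ⟨A, hA, hle⟩ := exists_separator_withDensity_le hm hC
    (fun x y hxy => ((hs x y).1 hxy).2) hε3 (L := L) (M := M)
    (by rwa [div_le_iff₀ hε3] at hL) hM2
    (by
      have := (le_max_right _ _).trans hM
      rwa [div_le_iff₀ hε3, mul_comm (M : ℝ)] at this) hK (W := V)
    (hW'm.max measurable_const) (fun x => le_max_right _ _)
  refine ⟨A, hA, ?_⟩
  have h3 : 3 * (ε / 3) = ε := by ring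
  rw [h3] at hle
  rw [integral_eq_lintegral_of_nonneg_ae (Eventually.of_forall hW0) hW.1.restrict,
    integral_eq_lintegral_of_nonneg_ae (Eventually.of_forall hW0) hW.1,
    ← ENNReal.toReal_ofReal hε.le, ← ENNReal.toReal_mul]
  have hfin : ∫⁻ x, ENNReal.ofReal (W x) ∂μ ≠ ⊤ := by
    have := hW.2
    rw [hasFiniteIntegral_iff_ofReal (Eventually.of_forall hW0)] at this
    exact this.ne
  refine ENNReal.toReal_mono (ENNReal.mul_ne_top ENNReal.ofReal_ne_top hfin) ?_
  have e1 : ∫⁻ x, ENNReal.ofReal (W x) ∂μ = ∫⁻ x, ENNReal.ofReal (V x) ∂μ :=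
    lintegral_congr_ae (hWV.mono fun x hx => by simp only [hx])
  have e2 : ∫⁻ x in A, ENNReal.ofReal (W x) ∂μ = ∫⁻ x in A, ENNReal.ofReal (V x) ∂μ :=
    lintegral_congr_ae (ae_restrict_of_ae (hWV.mono fun x hx => by simp only [hx]))
  rw [e1, e2]
  exact hle

end Weighted

/-! ### Hahn–Banach separation and weak limits of separator combinations. -/

section WeakLimits

variable {X : Type u} [MeasurableSpace X] {G : SimpleGraph X} {μ : Measure X} {K : ℕ}

theorem isSeparatorCombination_of_fintype {ι : Type*} [Fintype ι] {t : ι → ℝ} {Y : ι → Set X}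
    {z : X → ℝ} (ht : ∀ i, 0 ≤ t i) (ht1 : ∑ i, t i = 1) (hY : ∀ i, IsSeparator G K (Y i))
    (hz : Measurable z) (hz0 : ∀ x, 0 ≤ z x) (hzc : ∃ c : ℝ, ∀ x, z x ≤ c) :
    IsSeparatorCombination G K
      (fun x => ∑ i, t i * (Y i).indicator (fun _ => (1 : ℝ)) x + z x) := by
  let e := Fintype.equivFin ι
  refine ⟨Fintype.card ι, t ∘ e.symm, Y ∘ e.symm, z, fun i => ht _, ?_, fun i => hY _, hz, hz0, hzc,
    fun x => ?_⟩
  · rw [← ht1]; exact e.symm.sum_comp t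
  · refine congrArg (· + z x) ?_
    exact (e.symm.sum_comp fun i => t i * (Y i).indicator (fun _ => (1 : ℝ)) x).symm

theorem IsSeparatorCombination.convexComb {f g : X → ℝ} (hf : IsSeparatorCombination G K f)
    (hg : IsSeparatorCombination G K g) {a b : ℝ} (ha : 0 ≤ a) (hb : 0 ≤ b) (hab : a + b = 1) :
    IsSeparatorCombination G K (fun x => a * f x + b * g x) := by
  obtain ⟨m, t, Y, z, ht, ht1, hY, hz, hz0, ⟨c, hc⟩, hf⟩ := hf
  obtain ⟨m', t', Y', z', ht', ht1', hY', hz', hz0', ⟨c', hc'⟩, hg⟩ := hg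
  have := isSeparatorCombination_of_fintype (G := G) (K := K)
    (t := Sum.elim (fun i => a * t i) (fun i => b * t' i)) (Y := Sum.elim Y Y')
    (z := fun x => a * z x + b * z' x)
    (by rintro (i | i)
        · exact mul_nonneg ha (ht i)
        · exact mul_nonneg hb (ht' i))
    (by simp [← Finset.mul_sum, ht1, ht1', hab])
    (by rintro (i | i)
        · exact hY i
        · exact hY' i)
    ((hz.const_mul a).add (hz'.const_mul b))
    (fun x => add_nonneg (mul_nonneg ha (hz0 x)) (mul_nonneg hb (hz0' x)))
    ⟨a * c + b * c', fun x => by gcongr; exacts [hc x, hc' x]⟩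
  convert this using 2 with x
  rw [hf, hg]
  simp only [Fintype.sum_sum_type, Sum.elim_inl, Sum.elim_inr, mul_add, Finset.mul_sum, mul_assoc]
  ring

theorem isSeparator_univ : IsSeparator G K (Set.univ : Set X) :=
  ⟨MeasurableSet.univ, componentsAtMost_iff.2 fun x hx => absurd (Set.mem_univ x) hx⟩

theorem IsSeparator.isSeparatorCombination {Y : Set X} (hY : IsSeparator G K Y) {z : X → ℝ}
    (hz : Measurable z) (hz0 : ∀ x, 0 ≤ z x) (hzc : ∃ c : ℝ, ∀ x, z x ≤ c) :
    IsSeparatorCombination G K (fun x => Y.indicator (fun _ => (1 : ℝ)) x + z x) := by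
  have := isSeparatorCombination_of_fintype (G := G) (K := K) (ι := Unit) (t := fun _ => 1)
    (Y := fun _ => Y) (z := z) (by simp) (by simp) (fun _ => hY) hz hz0 hzc
  simpa using this

theorem IsSeparatorCombination.measurable {f : X → ℝ} (hf : IsSeparatorCombination G K f) :
    Measurable f := by
  obtain ⟨m, t, Y, z, ht, ht1, hY, hz, hz0, hc, hf⟩ := hf
  rw [funext hf]
  exact (Finset.measurable_sum _ fun i _ =>
    (measurable_const.indicator (hY i).1).const_mul _).add hz

theorem IsSeparatorCombination.memLp [IsFiniteMeasure μ] {f : X → ℝ}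
    (hf : IsSeparatorCombination G K f) : MemLp f 2 μ := by
  have hm := hf.measurable
  obtain ⟨m, t, Y, z, ht, ht1, hY, hz, hz0, ⟨c, hc⟩, hf⟩ := hf
  refine MemLp.of_bound hm.aestronglyMeasurable (1 + c) (Eventually.of_forall fun x => ?_)
  have h0 : ∀ i, 0 ≤ t i * (Y i).indicator (fun _ => (1 : ℝ)) x := fun i =>
    mul_nonneg (ht i) (Set.indicator_nonneg (fun _ _ => zero_le_one) x)
  rw [hf, Real.norm_eq_abs, abs_of_nonneg (add_nonneg (Finset.sum_nonneg fun i _ => h0 i) (hz0 x))]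
  refine add_le_add ((Finset.sum_le_sum fun i _ => ?_).trans_eq ht1) ?_
  · exact mul_le_of_le_one_right (ht i) (Set.indicator_le_self' (fun _ _ => zero_le_one) x)
  · exact hc x

/-- Either the constant `ε` is an `L²`-limit of separator combinations, or some functional
separates it strictly from all of them. -/
theorem exists_tendsto_or_exists_separating [IsFiniteMeasure μ] (G : SimpleGraph X) (K : ℕ)
    (ε : ℝ) :
    (∃ f : ℕ → X → ℝ, (∀ n, IsSeparatorCombination G K (f n)) ∧
      (∀ h : X → ℝ, MemLp h 2 μ →
        Tendsto (fun n => ∫ x, f n x * h x ∂μ) atTop (𝓝 (∫ x, ε * h x ∂μ))) ∧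
      ∃ ns : ℕ → ℕ, ∀ᵐ x ∂μ, Tendsto (fun n => f (ns n) x) atTop (𝓝 ε)) ∨
    ∃ (h : X → ℝ) (u : ℝ), MemLp h 2 μ ∧ ∫ x, ε * h x ∂μ < u ∧
      ∀ f, IsSeparatorCombination G K f → u < ∫ x, f x * h x ∂μ := by
  set C : Set (Lp ℝ 2 μ) := {F | ∃ f, IsSeparatorCombination G K f ∧ F =ᵐ[μ] f} with hC
  have hconv : Convex ℝ C := by
    rintro F ⟨f, hf, hFf⟩ F' ⟨f', hf', hFf'⟩ a b ha hb hab
    refine ⟨_, hf.convexComb hf' ha hb hab, ?_⟩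
    filter_upwards [Lp.coeFn_add (a • F) (b • F'), Lp.coeFn_smul a F, Lp.coeFn_smul b F', hFf, hFf']
      with x h1 h2 h3 h4 h5
    rw [h1, Pi.add_apply, h2, h3, Pi.smul_apply, Pi.smul_apply, h4, h5, smul_eq_mul, smul_eq_mul]
  have hε : MemLp (fun _ : X => ε) 2 μ := memLp_const ε
  have hinner : ∀ (H F : Lp ℝ 2 μ) (h f : X → ℝ), H =ᵐ[μ] h → F =ᵐ[μ] f →
      inner ℝ H F = ∫ x, f x * h x ∂μ := by
    intro H F h f hH hF
    rw [L2.inner_def]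
    refine integral_congr_ae ?_
    filter_upwards [hH, hF] with x h1 h2
    simp [h1, h2]
  -- The closure is taken in norm. Membership gives weak convergence and an almost everywhere
  -- convergent subsequence; otherwise convexity allows a strict separation.
  by_cases hmem : hε.toLp ∈ closure C
  · left
    obtain ⟨F, hF, hlim⟩ := mem_closure_iff_seq_limit.1 hmem
    choose f hf hFf using hF
    refine ⟨f, hf, fun h hh => ?_, ?_⟩
    · have h1 : Tendsto (fun n => inner ℝ hh.toLp (F n)) atTop (𝓝 (inner ℝ hh.toLp hε.toLp)) :=
        ((continuous_const.inner continuous_id).tendsto _).comp hlim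
      rw [hinner _ _ h (fun _ => ε) hh.coeFn_toLp hε.coeFn_toLp] at h1
      simpa only [hinner _ _ h _ hh.coeFn_toLp (hFf _)] using h1
    · obtain ⟨ns, -, hns⟩ := (tendstoInMeasure_of_tendsto_Lp hlim).exists_seq_tendsto_ae
      refine ⟨ns, ?_⟩
      filter_upwards [hns, hε.coeFn_toLp, ae_all_iff.2 fun n => hFf n] with x h1 h2 h3
      simp only [h3, h2] at h1
      exact h1
  · right
    obtain ⟨φ, u, h1, h2⟩ := geometric_hahn_banach_point_closed hconv.closure isClosed_closure hmem
    set H := (InnerProductSpace.toDual ℝ (Lp ℝ 2 μ)).symm φ with hH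
    have hφ : ∀ F, φ F = inner ℝ H F := fun F => by
      rw [hH, InnerProductSpace.toDual_symm_apply]
    refine ⟨H, u, Lp.memLp H, ?_, fun f hf => ?_⟩
    · rwa [hφ, hinner _ _ H (fun _ => ε) (ae_eq_refl _) hε.coeFn_toLp] at h1
    · have := h2 _ (subset_closure ⟨f, hf, (hf.memLp (μ := μ)).coeFn_toLp⟩)
      rwa [hφ, hinner _ _ H f (ae_eq_refl _) (hf.memLp (μ := μ)).coeFn_toLp] at this

theorem IsWeightedHyperfiniteWith.isApproxStronglyHyperfiniteWith [IsFiniteMeasure μ] {ε : ℝ}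
    (h : IsWeightedHyperfiniteWith G μ ε K) : IsApproxStronglyHyperfiniteWith G μ ε K := by
  rcases exists_tendsto_or_exists_separating (μ := μ) G K ε with ⟨f, hf, hlim, -⟩ | ⟨w, u, hw, hu, hsep⟩
  · exact ⟨f, hf, hlim⟩
  exfalso
  set v : X → ℝ := hw.1.mk w with hv
  have hwv : w =ᵐ[μ] v := hw.1.ae_eq_mk
  have hvm : Measurable v := hw.1.stronglyMeasurable_mk.measurable
  have hvi : Integrable v μ := (hw.integrable one_le_two).congr hwv
  have hint : ∀ f : X → ℝ, ∫ x, f x * w x ∂μ = ∫ x, f x * v x ∂μ := fun f =>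
    integral_congr_ae (hwv.mono fun x hx => by simp only [hx])
  rw [hint] at hu
  simp only [hint] at hsep
  set N := {x | v x < 0} with hN
  have hNm : MeasurableSet N := measurableSet_lt hvm measurable_const
  -- Adding large multiples of the indicator of `N` as the term `z` would drive the functional to
  -- `-∞`, so the separating function is non-negative almost everywhere.
  have hneg : 0 ≤ ∫ x in N, v x ∂μ := by
    by_contra! hlt
    obtain ⟨n, hn⟩ := exists_nat_ge ((∫ x, v x ∂μ - u) / -(∫ x in N, v x ∂μ))
    rw [div_le_iff₀ (by linarith)] at hn
    have h1 := hsep _ (isSeparator_univ.isSeparatorCombination (G := G) (K := K)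
      (z := N.indicator fun _ => (n : ℝ)) (measurable_const.indicator hNm)
      (Set.indicator_nonneg fun _ _ => by positivity)
      ⟨n, fun x => Set.indicator_le_self' (fun _ _ => by positivity) x⟩)
    have h2 : ∫ x, (Set.univ.indicator (fun _ => (1 : ℝ)) x + N.indicator (fun _ => (n : ℝ)) x) * v x ∂μ
        = ∫ x, v x ∂μ + n * ∫ x in N, v x ∂μ := by
      rw [← integral_indicator hNm, ← integral_const_mul, ← integral_add hvi
        ((hvi.indicator hNm).const_mul _)]
      congr 1 with x
      by_cases hx : x ∈ N <;> (simp [hx]; try ring)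
    rw [h2] at h1
    linarith
  have hv0 : ∀ᵐ x ∂μ, 0 ≤ v x := by
    have h1 : 0 ≤ᵐ[μ.restrict N] fun x => - v x :=
      (ae_restrict_mem hNm).mono fun x (hx : v x < 0) => by simpa using hx.le
    have h2 : ∫ x in N, - v x ∂μ = 0 := by
      refine le_antisymm ?_ (integral_nonneg_of_ae h1)
      rw [integral_neg]; linarith
    have h3 := (integral_eq_zero_iff_of_nonneg_ae h1 hvi.restrict.neg).1 h2
    have h4 := (ae_restrict_iff' hNm).1 h3
    filter_upwards [h4] with x hx
    by_contra! hlt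
    have := hx hlt
    simp only [Pi.zero_apply, neg_eq_zero] at this
    linarith
  set W : X → ℝ := fun x => max (v x) 0 with hW
  have hWv : W =ᵐ[μ] v := hv0.mono fun x hx => max_eq_left hx
  -- Weighted hyperfiniteness yields a separator with `∫_A v ≤ ε ∫ v < u`, although the separation
  -- gives `u < ∫_A v`.
  obtain ⟨A, hA, hle⟩ := h W (fun x => le_max_right _ _) (hvi.congr hWv.symm)
  have h1 := hsep _ (hA.isSeparatorCombination (z := 0) measurable_const (fun _ => le_rfl)
    ⟨0, fun _ => le_rfl⟩)
  have h2 : ∫ x, (A.indicator (fun _ => (1 : ℝ)) x + (0 : X → ℝ) x) * v x ∂μ = ∫ x in A, W x ∂μ := by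
    rw [integral_congr_ae (ae_restrict_of_ae hWv), ← integral_indicator hA.1]
    congr 1 with x
    by_cases hx : x ∈ A <;> simp [hx]
  rw [h2] at h1
  rw [integral_congr_ae hWv, ← integral_const_mul] at hle
  linarith

/-- Mazur's principle: a weak limit of separator combinations cannot be strictly separated from
them, which leaves the alternative with almost everywhere convergence. -/
theorem IsApproxStronglyHyperfiniteWith.exists_tendsto_ae [IsFiniteMeasure μ] {ε : ℝ}
    (h : IsApproxStronglyHyperfiniteWith G μ ε K) :
    ∃ f : ℕ → X → ℝ, (∀ n, IsSeparatorCombination G K (f n)) ∧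
      ∀ᵐ x ∂μ, Tendsto (fun n => f n x) atTop (𝓝 ε) := by
  rcases exists_tendsto_or_exists_separating (μ := μ) G K ε with
    ⟨f, hf, -, ns, hns⟩ | ⟨w, u, hw, hu, hsep⟩
  · exact ⟨fun n => f (ns n), fun n => hf _, hns⟩
  · obtain ⟨f, hf, hlim⟩ := h
    exact absurd (ge_of_tendsto' (hlim w hw) fun n => (hsep _ (hf n)).le) (not_le.2 hu)

end WeakLimits

/-! ### Almost everywhere convergent convex combinations. -/

section ConvexCombinations

/-- Bounded sequences of functions on a finite measure space have almost everywhere convergent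
sequences of convex combinations of their tails. -/
theorem exists_convexHull_tendsto_ae {Ω : Type*} [MeasurableSpace Ω] (ν : Measure Ω)
    [IsFiniteMeasure ν] {u : ℕ → Ω → ℝ} (hm : ∀ n, Measurable (u n)) (hb : ∀ n x, |u n x| ≤ 1) :
    ∃ v : ℕ → Ω → ℝ, (∀ n, v n ∈ convexHull ℝ (u '' Set.Ici n)) ∧
      ∀ᵐ x ∂ν, ∃ l, Tendsto (fun n => v n x) atTop (𝓝 l) := by
  set E : ℕ → Set (Ω → ℝ) := fun n => convexHull ℝ (u '' Set.Ici n) with hE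
  have hS : Convex ℝ {f : Ω → ℝ | Measurable f ∧ ∀ x, |f x| ≤ 1} := by
    rintro f ⟨hf, hf1⟩ g ⟨hg, hg1⟩ a b ha hb hab
    refine ⟨(hf.const_smul a).add (hg.const_smul b), fun x => ?_⟩
    simp only [Pi.add_apply, Pi.smul_apply, smul_eq_mul]
    refine (abs_add_le _ _).trans ?_
    rw [abs_mul, abs_mul, abs_of_nonneg ha, abs_of_nonneg hb, ← hab]
    exact add_le_add (mul_le_of_le_one_right ha (hf1 x)) (mul_le_of_le_one_right hb (hg1 x))
  have hES : ∀ n, ∀ f ∈ E n, Measurable f ∧ ∀ x, |f x| ≤ 1 := by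
    intro n f hf
    refine convexHull_min ?_ hS hf
    rintro _ ⟨k, -, rfl⟩
    exact ⟨hm k, hb k⟩
  have hEanti : ∀ n m, n ≤ m → E m ⊆ E n := fun n m hnm =>
    convexHull_mono (Set.image_mono (Set.Ici_subset_Ici.2 hnm))
  have hLp : ∀ n, ∀ f ∈ E n, MemLp f 2 ν := fun n f hf =>
    MemLp.of_bound (hES n f hf).1.aestronglyMeasurable 1
      (Eventually.of_forall (hES n f hf).2)
  set N : (Ω → ℝ) → ℝ := fun f => ∫ x, f x ^ 2 ∂ν with hN
  have hN0 : ∀ f, 0 ≤ N f := fun f => integral_nonneg fun x => sq_nonneg _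
  have hN1 : ∀ n, ∀ f ∈ E n, N f ≤ ν.real Set.univ := by
    intro n f hf
    calc N f ≤ ∫ _, (1 : ℝ) ∂ν := by
          refine integral_mono_of_nonneg (Eventually.of_forall fun x => sq_nonneg _)
            (integrable_const _) (Eventually.of_forall fun x => ?_)
          exact (sq_le_one_iff_abs_le_one _).2 ((hES n f hf).2 x)
      _ = _ := by simp
  have hbdd : ∀ n, BddBelow (N '' E n) := fun n => ⟨0, by rintro _ ⟨f, -, rfl⟩; exact hN0 f⟩
  have hne : ∀ n, u n ∈ E n := fun n => subset_convexHull ℝ _ ⟨n, Set.self_mem_Ici, rfl⟩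
  -- The minimal squared norms of the tail hulls increase to a finite limit. Near-minimisers are
  -- Cauchy by the parallelogram identity, since the midpoint of `w n` and `w m` stays in `E n`.
  set a : ℕ → ℝ := fun n => sInf (N '' E n) with ha
  have hale : ∀ n, ∀ f ∈ E n, a n ≤ N f := fun n f hf => csInf_le (hbdd n) ⟨f, hf, rfl⟩
  have hamono : Monotone a := fun n m hnm =>
    csInf_le_csInf (hbdd n) ⟨_, _, hne m, rfl⟩ (Set.image_mono (hEanti n m hnm))
  have habdd : BddAbove (Set.range a) := by
    refine ⟨ν.real Set.univ, ?_⟩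
    rintro _ ⟨n, rfl⟩
    exact (hale n _ (hne n)).trans (hN1 n _ (hne n))
  have hexw : ∀ n : ℕ, ∃ w ∈ E n, N w < a n + 1 / ((n : ℝ) + 1) := by
    intro n
    obtain ⟨_, ⟨w, hw, rfl⟩, hlt⟩ := exists_lt_of_csInf_lt (s := N '' E n) ⟨_, _, hne n, rfl⟩
      (lt_add_of_pos_right (a n) (by positivity : (0 : ℝ) < 1 / ((n : ℝ) + 1)))
    exact ⟨w, hw, hlt⟩
  choose w hw hwN using hexw
  have hpar : ∀ n m, n ≤ m → N (w n - w m) ≤ 2 * ((⨆ k, a k) - a n) + 4 * (1 / ((n : ℝ) + 1)) := by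
    intro n m hnm
    have hmid : (1 / 2 : ℝ) • w n + (1 / 2 : ℝ) • w m ∈ E n :=
      convex_convexHull ℝ _ (hw n) (hEanti n m hnm (hw m)) (by norm_num) (by norm_num) (by norm_num)
    have hid : N (w n - w m) = 2 * N (w n) + 2 * N (w m) -
        4 * N ((1 / 2 : ℝ) • w n + (1 / 2 : ℝ) • w m) := by
      simp only [hN]
      have i1 := (hLp n _ (hw n)).integrable_sq
      have i2 := (hLp m _ (hw m)).integrable_sq
      have i3 := (hLp n _ hmid).integrable_sq
      have i4 : Integrable (fun x => 2 * w n x ^ 2 + 2 * w m x ^ 2) ν :=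
        (i1.const_mul 2).add (i2.const_mul 2)
      rw [← integral_const_mul, ← integral_const_mul, ← integral_const_mul,
        ← integral_add (i1.const_mul 2) (i2.const_mul 2), ← integral_sub i4 (i3.const_mul 4)]
      congr 1 with x
      simp only [Pi.sub_apply, Pi.add_apply, Pi.smul_apply, smul_eq_mul]
      ring
    have h1 := hale n _ hmid
    have h2 : a m ≤ ⨆ k, a k := le_ciSup habdd m
    have h3 : 1 / ((m : ℝ) + 1) ≤ 1 / ((n : ℝ) + 1) := by gcongr
    linarith [hwN n, hwN m, hamono hnm]
  have hnorm : ∀ n m, ‖(hLp n _ (hw n)).toLp - (hLp m _ (hw m)).toLp‖ = √(N (w n - w m)) := by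
    intro n m
    rw [← MemLp.toLp_sub, norm_eq_sqrt_real_inner, L2.inner_def]
    congr 1
    refine integral_congr_ae ?_
    filter_upwards [((hLp n _ (hw n)).sub (hLp m _ (hw m))).coeFn_toLp] with x hx
    rw [hx]
    simp [sq]
  have hcauchy : CauchySeq fun n => (hLp n _ (hw n)).toLp := by
    refine cauchySeq_of_le_tendsto_0'
      (fun n : ℕ => √(2 * ((⨆ k, a k) - a n) + 4 * (1 / ((n : ℝ) + 1)))) ?_ ?_
    · intro n m hnm
      rw [dist_eq_norm, hnorm]
      exact Real.sqrt_le_sqrt (hpar n m hnm)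
    · have h1 : Tendsto (fun n : ℕ => 2 * ((⨆ k, a k) - a n) + 4 * (1 / ((n : ℝ) + 1))) atTop
          (𝓝 (2 * ((⨆ k, a k) - ⨆ k, a k) + 4 * 0)) :=
        ((tendsto_const_nhds.sub (tendsto_atTop_ciSup hamono habdd)).const_mul 2).add
          (tendsto_one_div_add_atTop_nhds_zero_nat.const_mul 4)
      simpa using h1.sqrt
  obtain ⟨F, hF⟩ := cauchySeq_tendsto_of_complete hcauchy
  obtain ⟨ns, hns, hlim⟩ := (tendstoInMeasure_of_tendsto_Lp hF).exists_seq_tendsto_ae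
  refine ⟨fun n => w (ns n), fun n => hEanti _ _ (hns.le_apply) (hw _), ?_⟩
  filter_upwards [hlim, ae_all_iff.2 fun n => (hLp n _ (hw n)).coeFn_toLp] with x h1 h2
  refine ⟨F x, ?_⟩
  simpa only [h2] using h1

end ConvexCombinations

/-! ### `K`-subsets and the partition defined by a separator. -/

section KSubsets

variable {X : Type u} {G : SimpleGraph X} {K : ℕ}

theorem induce_connected_iff {S : Set X} :
    (G.induce S).Connected ↔ S.Nonempty ∧ ∀ x ∈ S, ∀ y ∈ S, JoinedIn G S x y := by
  rw [SimpleGraph.connected_iff, and_comm, Set.nonempty_coe_sort]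
  refine and_congr_right fun _ => ⟨fun h x hx y hy => ?_, fun h x y => ?_⟩
  · exact (reachable_induce_iff (⟨x, hx⟩ : S) ⟨y, hy⟩).1 (h _ _)
  · exact (reachable_induce_iff x y).2 (h x x.2 y y.2)

theorem JoinedIn.mono {S S' : Set X} (hS : S ⊆ S') {x y : X} (h : JoinedIn G S x y) :
    JoinedIn G S' x y :=
  Relation.ReflTransGen.mono (fun _ _ h => ⟨h.1, hS h.2.1, hS h.2.2⟩) x y h

theorem JoinedIn.symm {S : Set X} {x y : X} (h : JoinedIn G S x y) : JoinedIn G S y x := by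
  induction h with
  | refl => exact .refl
  | tail _ h ih => exact Relation.ReflTransGen.head ⟨h.1.symm, h.2.2, h.2.1⟩ ih

/-- A simple path inside `A` has fewer than `|A| ≤ K` edges. -/
theorem KSubset.mem_graphBall (A : KSubset G K) {x y : X} (hx : x ∈ A.1) (hy : y ∈ A.1) :
    y ∈ graphBall G x K := by
  classical
  obtain ⟨p⟩ := A.2.2.preconnected ⟨x, hx⟩ ⟨y, hy⟩
  have h1 := p.toPath.2.length_lt
  have h2 : (p.toPath.1.map (SimpleGraph.Embedding.induce _).toHom).length ≤ K := by
    rw [SimpleGraph.Walk.length_map]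
    refine h1.le.trans (le_trans (le_of_eq ?_) A.2.1)
    simp
  exact mem_graphBall_of_walk _ h2

theorem KSubset.finite_mem {F : Finset X} {x : X} (hF : graphBall G x K ⊆ F) :
    Finite {A : KSubset G K // x ∈ A.1} := by
  refine Finite.of_injective (β := F.powerset)
    (fun A => ⟨A.1.1, Finset.mem_powerset.2 fun y hy => hF (A.1.mem_graphBall A.2 hy)⟩) ?_
  intro A B h
  exact Subtype.ext (Subtype.ext (congrArg (fun S : F.powerset => S.1) h))

/-- The classes of the partition of `X` into the components of `Yᶜ` and the points of `Y`, among
the finite sets inducing connected graphs. -/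
def partitionClasses {ι : Type*} (s : ι → X → X) (Y : Set X) : Set (Finset X) :=
  {L | (∀ x ∈ L, x ∉ Y) ∧ ∀ x ∈ L, ∀ i, s i x ∈ Y ∨ s i x ∈ L} ∪
    {L | ∃ y ∈ Y, y ∈ L ∧ ∀ x ∈ L, x = y}

/-- The class of `x` is `{x}` if `x ∈ Y`, and otherwise its component in `Yᶜ`: a connected set
avoiding `Y` that generators leave only into `Y` must be a full component. -/
theorem existsUnique_mem_partitionClasses {ι : Type*} {s : ι → X → X}
    (hs : ∀ x y, G.Adj x y ↔ x ≠ y ∧ ∃ i, y = s i x) (hK : 1 ≤ K) {Y : Set X}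
    (hY : ComponentsAtMost G Yᶜ K) (x : X) :
    ∃ A : {A : KSubset G K // x ∈ A.1}, A.1.1 ∈ partitionClasses s Y ∧
      ∀ B : {A : KSubset G K // x ∈ A.1}, B.1.1 ∈ partitionClasses s Y → B = A := by
  classical
  by_cases hx : x ∈ Y
  · refine ⟨⟨⟨{x}, by simpa using hK, ?_⟩, by simp⟩, Or.inr ⟨x, hx, by simp, by simp⟩, ?_⟩
    · rw [induce_connected_iff]
      refine ⟨⟨x, by simp⟩, fun y hy z hz => ?_⟩
      simp only [Finset.coe_singleton, Set.mem_singleton_iff] at hy hz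
      rw [hy, hz]
      exact .refl
    · rintro ⟨B, hB⟩ (h | ⟨y, hy, hyB, h⟩)
      · exact absurd hx (h.1 x hB)
      · refine Subtype.ext (Subtype.ext ?_)
        obtain rfl := h x hB
        exact Finset.eq_singleton_iff_unique_mem.2 ⟨hB, h⟩
  · have hc := componentsAtMost_iff.1 hY x hx
    have hfin : {y | JoinedIn G Yᶜ x y}.Finite := Set.finite_of_encard_le_coe hc
    have hmem : ∀ y, y ∈ hfin.toFinset ↔ JoinedIn G Yᶜ x y := fun y => by simp
    have hcon : (G.induce (hfin.toFinset : Set X)).Connected := by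
      rw [induce_connected_iff]
      have hjoin : ∀ y, JoinedIn G Yᶜ x y → JoinedIn G (hfin.toFinset : Set X) x y := by
        intro y hy
        induction hy with
        | refl => exact .refl
        | tail h1 h2 ih => exact ih.tail ⟨h2.1, (hmem _).2 h1, (hmem _).2 (h1.tail h2)⟩
      refine ⟨⟨x, (hmem _).2 .refl⟩, fun y hy z hz => ?_⟩
      have h1 := hjoin y ((hmem y).1 hy)
      refine Relation.ReflTransGen.trans ?_ (hjoin z ((hmem z).1 hz))
      exact JoinedIn.symm h1
    refine ⟨⟨⟨hfin.toFinset, ?_, hcon⟩, (hmem _).2 .refl⟩, Or.inl ⟨?_, ?_⟩, ?_⟩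
    · rw [hfin.encard_eq_coe_toFinset_card] at hc
      exact_mod_cast hc
    · intro y hy
      exact JoinedIn.mem ((hmem y).1 hy) hx
    · intro y hy i
      by_cases h1 : s i y ∈ Y
      · exact Or.inl h1
      · right
        by_cases h2 : y = s i y
        · rw [← h2]; exact hy
        · have hyx := (hmem y).1 hy
          exact (hmem _).2 (hyx.tail ⟨(hs _ _).2 ⟨h2, i, rfl⟩, hyx.mem hx, h1⟩)
    · rintro ⟨B, hB⟩ (h | ⟨y, hy, hyB, h⟩)
      · refine Subtype.ext (Subtype.ext (Finset.Subset.antisymm ?_ ?_))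
        · intro y hy
          refine (hmem y).2 (((induce_connected_iff.1 B.2.2).2 x hB y hy).mono ?_)
          exact fun z hz => h.1 z hz
        · intro y hy
          have hj := (hmem y).1 hy
          induction hj with
          | refl => exact hB
          | tail h1 h2 ih =>
            obtain ⟨i, rfl⟩ := ((hs _ _).1 h2.1).2
            exact (h.2 _ (ih ((hmem _).2 h1)) i).resolve_left h2.2.2
      · exact absurd (h x hB ▸ hy) hx

end KSubsets

/-! ### The Borel structure on finite sets. -/

section FinsetBorel

variable {X : Type u} [MeasurableSpace X] {G : SimpleGraph X} {K : ℕ}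

attribute [local instance] finsetMeasurableSpace

open Classical in
theorem measurableSet_finset_iff {M : Set (Finset X)} :
    MeasurableSet M ↔ ∀ n, MeasurableSet {v : Fin n → X | Finset.univ.image v ∈ M} :=
  MeasurableSpace.measurableSet_iInf

-- The map factors through the tuple of values indexed by `J`, on which the quotient Borel structure
-- is tested.
open Classical in
theorem measurable_finset_image {Ω : Type*} [MeasurableSpace Ω] {N : ℕ} {φ : Fin N → Ω → X}
    (hφ : ∀ j, Measurable (φ j)) (J : Finset (Fin N)) :
    Measurable fun x => J.image fun j => φ j x := by
  intro M hM
  have h := measurableSet_finset_iff.1 hM J.card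
  have hv : Measurable fun x => fun k : Fin J.card => φ (J.equivFin.symm k) x :=
    measurable_pi_lambda _ fun k => hφ _
  convert hv h using 1
  ext x
  simp only [Set.mem_preimage, Set.mem_ofPred_eq]
  have : (Finset.univ.image fun k : Fin J.card => φ (J.equivFin.symm k) x)
      = J.image fun j => φ j x := by
    ext y
    simp only [Finset.mem_image, Finset.mem_univ, true_and]
    constructor
    · rintro ⟨k, rfl⟩
      exact ⟨_, (J.equivFin.symm k).2, rfl⟩
    · rintro ⟨j, hj, rfl⟩
      exact ⟨J.equivFin ⟨j, hj⟩, by simp⟩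
  rw [this]

theorem KSubset.measurable_val : Measurable fun A : KSubset G K => A.1 :=
  comap_measurable _

theorem measurableSet_partitionClasses [StandardBorelSpace X] {ι : Type*} [Countable ι]
    {s : ι → X → X} (hs : ∀ i, Measurable (s i)) {Y : Set X} (hY : MeasurableSet Y) :
    MeasurableSet (partitionClasses s Y) := by
  classical
  rw [measurableSet_finset_iff]
  intro n
  have : {v : Fin n → X | Finset.univ.image v ∈ partitionClasses s Y} =
      ((⋂ k, {v | v k ∈ Yᶜ}) ∩ ⋂ k, ⋂ i, ({v | s i (v k) ∈ Y} ∪ ⋃ l, {v | s i (v k) = v l})) ∪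
        ⋃ k, ({v | v k ∈ Y} ∩ ⋂ l, {v | v l = v k}) := by
    ext v
    simp [partitionClasses, eq_comm]
  rw [this]
  refine MeasurableSet.union (MeasurableSet.inter ?_ ?_) ?_
  · exact MeasurableSet.iInter fun k => hY.compl.preimage (measurable_pi_apply k)
  · refine MeasurableSet.iInter fun k => MeasurableSet.iInter fun i => MeasurableSet.union
      (hY.preimage ((hs i).comp (measurable_pi_apply k))) (MeasurableSet.iUnion fun l => ?_)
    exact measurableSet_eq_fun ((hs i).comp (measurable_pi_apply k)) (measurable_pi_apply l)
  · refine MeasurableSet.iUnion fun k => MeasurableSet.inter (hY.preimage (measurable_pi_apply k))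
      (MeasurableSet.iInter fun l => ?_)
    exact measurableSet_eq_fun (measurable_pi_apply l) (measurable_pi_apply k)

end FinsetBorel

/-! ### Linearity, limits and bounds for sums over `K`-subsets. -/

section FractionalPartitions

variable {X : Type u} {G : SimpleGraph X} {K : ℕ}

theorem finite_innerBoundary (hfin : ∀ x, Finite {A : KSubset G K // x ∈ A.1}) (x : X) :
    Finite {A : KSubset G K // x ∈ innerBoundary G (A.1 : Set X)} := by
  have := hfin x
  exact Finite.of_injective (β := {A : KSubset G K // x ∈ A.1}) (fun A => ⟨A.1, A.2.1⟩)
    fun A B h => Subtype.ext (congrArg (fun S : {A : KSubset G K // x ∈ A.1} => S.1) h)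

theorem starSum_sum (hfin : ∀ x, Finite {A : KSubset G K // x ∈ A.1}) {ι : Type*} [Fintype ι]
    (t : ι → ℝ) (Φ : ι → KSubset G K → ℝ) (x : X) :
    starSum G K (fun A => ∑ i, t i * Φ i A) x = ∑ i, t i * starSum G K (Φ i) x := by
  have := hfin x
  have := Fintype.ofFinite {A : KSubset G K // x ∈ A.1}
  simp only [starSum, tsum_fintype, Finset.mul_sum]
  exact Finset.sum_comm

theorem boundarySum_sum (hfin : ∀ x, Finite {A : KSubset G K // x ∈ A.1}) {ι : Type*} [Fintype ι]
    (t : ι → ℝ) (Φ : ι → KSubset G K → ℝ) (x : X) :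
    boundarySum G K (fun A => ∑ i, t i * Φ i A) x = ∑ i, t i * boundarySum G K (Φ i) x := by
  have := finite_innerBoundary hfin x
  have := Fintype.ofFinite {A : KSubset G K // x ∈ innerBoundary G (A.1 : Set X)}
  simp only [boundarySum, tsum_fintype, Finset.mul_sum]
  exact Finset.sum_comm

theorem tendsto_starSum (hfin : ∀ x, Finite {A : KSubset G K // x ∈ A.1})
    {Φ : ℕ → KSubset G K → ℝ} {Ψ : KSubset G K → ℝ} {x : X}
    (h : ∀ A : KSubset G K, x ∈ A.1 → Tendsto (fun n => Φ n A) atTop (𝓝 (Ψ A))) :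
    Tendsto (fun n => starSum G K (Φ n) x) atTop (𝓝 (starSum G K Ψ x)) := by
  have := hfin x
  have := Fintype.ofFinite {A : KSubset G K // x ∈ A.1}
  simp only [starSum, tsum_fintype]
  exact tendsto_finsetSum _ fun A _ => h A.1 A.2

theorem tendsto_boundarySum (hfin : ∀ x, Finite {A : KSubset G K // x ∈ A.1})
    {Φ : ℕ → KSubset G K → ℝ} {Ψ : KSubset G K → ℝ} {x : X}
    (h : ∀ A : KSubset G K, x ∈ A.1 → Tendsto (fun n => Φ n A) atTop (𝓝 (Ψ A))) :
    Tendsto (fun n => boundarySum G K (Φ n) x) atTop (𝓝 (boundarySum G K Ψ x)) := by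
  have := finite_innerBoundary hfin x
  have := Fintype.ofFinite {A : KSubset G K // x ∈ innerBoundary G (A.1 : Set X)}
  simp only [boundarySum, tsum_fintype]
  exact tendsto_finsetSum _ fun A _ => h A.1 A.2.1

theorem starSum_partitionClasses {ι : Type*} {s : ι → X → X}
    (hs : ∀ x y, G.Adj x y ↔ x ≠ y ∧ ∃ i, y = s i x) (hK : 1 ≤ K) {Y : Set X}
    (hY : ComponentsAtMost G Yᶜ K) (x : X) :
    starSum G K (fun A => (partitionClasses s Y).indicator (fun _ => (1 : ℝ)) A.1) x = 1 := by
  obtain ⟨A, hA, huniq⟩ := existsUnique_mem_partitionClasses hs hK hY x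
  unfold starSum
  rw [tsum_eq_single A fun B hB => ?_]
  · simp [hA]
  · exact Set.indicator_of_notMem (fun h => hB (huniq B h)) _

/-- Only one class contains `x`. If `x` is on its inner boundary, either the class is a singleton in
`Y`, or the outside neighbour `s i x` is in `Y`; one term on the right is then 1. -/
theorem boundarySum_partitionClasses_le {ι : Type*} [Fintype ι] {s : ι → X → X}
    (hs : ∀ x y, G.Adj x y ↔ x ≠ y ∧ ∃ i, y = s i x) (hK : 1 ≤ K) {Y : Set X}
    (hY : ComponentsAtMost G Yᶜ K) (x : X) :
    boundarySum G K (fun A => (partitionClasses s Y).indicator (fun _ => (1 : ℝ)) A.1) x ≤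
      Y.indicator (fun _ => (1 : ℝ)) x + ∑ i, Y.indicator (fun _ => (1 : ℝ)) (s i x) := by
  have h0 : ∀ y, 0 ≤ Y.indicator (fun _ => (1 : ℝ)) y :=
    Set.indicator_nonneg fun _ _ => zero_le_one
  unfold boundarySum
  by_cases hex : ∃ A : {A : KSubset G K // x ∈ innerBoundary G (A.1 : Set X)},
      A.1.1 ∈ partitionClasses s Y
  · obtain ⟨A, hA⟩ := hex
    rw [tsum_eq_single A fun B hB => ?_]
    · refine le_of_eq_of_le (Set.indicator_of_mem hA fun _ => (1 : ℝ)) ?_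
      obtain ⟨hxA, y, hy, hxy⟩ := A.2
      obtain ⟨i, rfl⟩ := ((hs _ _).1 hxy).2
      rcases hA with h | ⟨y, hyY, -, h⟩
      · have h1 : s i x ∈ Y := (h.2 x hxA i).resolve_right hy
        have h2 : Y.indicator (fun _ => (1 : ℝ)) (s i x) ≤
            ∑ i, Y.indicator (fun _ => (1 : ℝ)) (s i x) :=
          Finset.single_le_sum (f := fun i => Y.indicator (fun _ => (1 : ℝ)) (s i x))
            (fun i _ => h0 _) (Finset.mem_univ i)
        rw [Set.indicator_of_mem h1] at h2
        linarith [h0 x]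
      · rw [Set.indicator_of_mem (h x hxA ▸ hyY : x ∈ Y)]
        linarith [Finset.sum_nonneg fun i (_ : i ∈ Finset.univ) => h0 (s i x)]
    · refine Set.indicator_of_notMem (fun h => hB ?_) _
      obtain ⟨C, -, hC⟩ := existsUnique_mem_partitionClasses hs hK hY x
      have h1 := (hC ⟨A.1, A.2.1⟩ hA).trans (hC ⟨B.1, B.2.1⟩ h).symm
      exact Subtype.ext (congrArg (fun S : {A : KSubset G K // x ∈ A.1} => S.1) h1.symm)
  · push Not at hex
    rw [tsum_congr fun A => Set.indicator_of_notMem (hex A) _, tsum_zero]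
    exact add_nonneg (h0 x) (Finset.sum_nonneg fun i _ => h0 _)

/-- Finitely many measurable maps thus reach every `K`-subset containing `x`, which transfers almost
everywhere statements between finite sets and points. -/
theorem KSubset.exists_eq_image {N : ℕ} {φ : Fin N → X → X}
    (hφ : ∀ x, ∀ y ∈ graphBall G x K, ∃ j, y = φ j x) (A : KSubset G K) {x : X} (hx : x ∈ A.1) :
    ∃ J : Finset (Fin N), A.1 = (by classical exact J.image fun j => φ j x) := by
  classical
  refine ⟨Finset.univ.filter fun j => φ j x ∈ A.1, ?_⟩
  ext y
  simp only [Finset.mem_image, Finset.mem_filter, Finset.mem_univ, true_and]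
  constructor
  · intro hy
    obtain ⟨j, rfl⟩ := hφ x y (A.mem_graphBall hx hy)
    exact ⟨j, hy, rfl⟩
  · rintro ⟨j, hj, rfl⟩
    exact hj

theorem finite_kSubset_mem {N : ℕ} {φ : Fin N → X → X}
    (hφ : ∀ x, ∀ y ∈ graphBall G x K, ∃ j, y = φ j x) (x : X) :
    Finite {A : KSubset G K // x ∈ A.1} := by
  classical
  refine KSubset.finite_mem (F := Finset.univ.image fun j => φ j x) fun y hy => ?_
  obtain ⟨j, rfl⟩ := hφ x y hy
  simp

end FractionalPartitions

/-! ### From separator combinations to fractional partitions. -/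

section ApproxToFractional

variable {X : Type u} [MeasurableSpace X] {G : SimpleGraph X} {μ : Measure X} {K : ℕ}

attribute [local instance] finsetMeasurableSpace

theorem IsSeparatorCombination.exists_fractionalPartition [StandardBorelSpace X] {m : ℕ}
    {s : Fin m → X → X} (hm : ∀ i, Measurable (s i))
    (hs : ∀ x y, G.Adj x y ↔ x ≠ y ∧ ∃ i, y = s i x) (hK : 1 ≤ K)
    (hfin : ∀ x, Finite {A : KSubset G K // x ∈ A.1}) {f : X → ℝ}
    (hf : IsSeparatorCombination G K f) :
    ∃ Φ : Finset X → ℝ, Measurable Φ ∧ (∀ A, 0 ≤ Φ A ∧ Φ A ≤ 1) ∧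
      (∀ x, starSum G K (fun A => Φ A.1) x = 1) ∧
      ∀ x, boundarySum G K (fun A => Φ A.1) x ≤ f x + ∑ i, f (s i x) := by
  obtain ⟨k, t, Y, z, ht, ht1, hY, -, hz0, -, hf⟩ := hf
  have hind : ∀ i A, 0 ≤ (partitionClasses s (Y i)).indicator (fun _ => (1 : ℝ)) A ∧
      (partitionClasses s (Y i)).indicator (fun _ => (1 : ℝ)) A ≤ 1 := fun i A =>
    ⟨Set.indicator_nonneg (fun _ _ => zero_le_one) A,
      Set.indicator_le_self' (fun _ _ => zero_le_one) A⟩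
  refine ⟨fun A => ∑ i, t i * (partitionClasses s (Y i)).indicator (fun _ => (1 : ℝ)) A, ?_,
    fun A => ⟨?_, ?_⟩, fun x => ?_, fun x => ?_⟩
  · exact Finset.measurable_sum _ fun i _ => (measurable_const.indicator
      (measurableSet_partitionClasses hm (hY i).1)).const_mul _
  · exact Finset.sum_nonneg fun i _ => mul_nonneg (ht i) (hind i A).1
  · exact (Finset.sum_le_sum fun i _ => mul_le_of_le_one_right (ht i) (hind i A).2).trans_eq ht1
  · rw [starSum_sum hfin t fun i A =>
      (partitionClasses s (Y i)).indicator (fun _ => (1 : ℝ)) A.1]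
    simp only [starSum_partitionClasses hs hK (hY _).2, mul_one, ht1]
  · rw [boundarySum_sum hfin t fun i A =>
      (partitionClasses s (Y i)).indicator (fun _ => (1 : ℝ)) A.1]
    have hfx : ∀ y, ∑ i, t i * (Y i).indicator (fun _ => (1 : ℝ)) y ≤ f y := fun y => by
      rw [hf]; linarith [hz0 y]
    calc ∑ i, t i * boundarySum G K
            (fun A => (partitionClasses s (Y i)).indicator (fun _ => (1 : ℝ)) A.1) x
        ≤ ∑ i, t i * ((Y i).indicator (fun _ => (1 : ℝ)) x +
            ∑ j, (Y i).indicator (fun _ => (1 : ℝ)) (s j x)) :=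
          Finset.sum_le_sum fun i _ => mul_le_mul_of_nonneg_left
            (boundarySum_partitionClasses_le hs hK (hY i).2 x) (ht i)
      _ = ∑ i, t i * (Y i).indicator (fun _ => (1 : ℝ)) x +
            ∑ j, ∑ i, t i * (Y i).indicator (fun _ => (1 : ℝ)) (s j x) := by
          rw [Finset.sum_comm, ← Finset.sum_add_distrib]
          simp only [mul_add, Finset.mul_sum]
      _ ≤ _ := add_le_add (hfx x) (Finset.sum_le_sum fun j _ => hfx _)

/-- The factor `m + 1` counts `x` and its images under the `m` generators: the boundary sum at `x`
is controlled by the combination at all these points. -/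
theorem IsApproxStronglyHyperfiniteWith.isStronglyFractionallyHyperfiniteWith
    [StandardBorelSpace X] [IsFiniteMeasure μ] {m : ℕ} {s : Fin m → X → X}
    (hm : ∀ i, Measurable (s i)) (hac : ∀ i, μ.map (s i) ≪ μ)
    (hs : ∀ x y, G.Adj x y ↔ x ≠ y ∧ ∃ i, y = s i x) (hK : 1 ≤ K) {ε : ℝ}
    (h : IsApproxStronglyHyperfiniteWith G μ ε K) :
    IsStronglyFractionallyHyperfiniteWith G μ ((m + 1) * ε) K := by
  classical
  obtain ⟨f, hf, hlim⟩ := h.exists_tendsto_ae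
  obtain ⟨N, φ, hφm, hφ⟩ := exists_maps_graphBall_subset hm (fun x y h => ((hs x y).1 h).2) K
  have hfin : ∀ x, Finite {A : KSubset G K // x ∈ A.1} := finite_kSubset_mem hφ
  choose Φ hΦm hΦ01 hΦ1 hΦb using fun n => (hf n).exists_fractionalPartition hm hs hK hfin
  set T : Finset (Fin N) → X → Finset X := fun J x => J.image fun j => φ j x with hT
  have hTm : ∀ J, Measurable (T J) := fun J => by
    convert measurable_finset_image hφm J
  -- Convergence `ν`-almost everywhere means that, for `μ`-almost every `x`, there is convergence at
  -- every `K`-subset containing `x`.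
  set ν : Measure (Finset X) := Measure.sum fun J => μ.map (T J) with hν
  have : ∀ J, IsFiniteMeasure (μ.map (T J)) := fun J => Measure.isFiniteMeasure_map _ _
  obtain ⟨v, hv, hvlim⟩ := exists_convexHull_tendsto_ae ν hΦm
    (fun n A => abs_le.2 ⟨by linarith [(hΦ01 n A).1], (hΦ01 n A).2⟩)
  -- convexity of the properties of fractional partitions
  have hstar : ∀ (F F' : Finset X → ℝ) (a b : ℝ) (x : X),
      starSum G K (fun A => (a • F + b • F') A.1) x =
        a * starSum G K (fun A => F A.1) x + b * starSum G K (fun A => F' A.1) x := by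
    intro F F' a b x
    simpa [Fin.sum_univ_two] using
      starSum_sum hfin ![a, b] ![fun A => F A.1, fun A => F' A.1] x
  have hbdry : ∀ (F F' : Finset X → ℝ) (a b : ℝ) (x : X),
      boundarySum G K (fun A => (a • F + b • F') A.1) x =
        a * boundarySum G K (fun A => F A.1) x + b * boundarySum G K (fun A => F' A.1) x := by
    intro F F' a b x
    simpa [Fin.sum_univ_two] using
      boundarySum_sum hfin ![a, b] ![fun A => F A.1, fun A => F' A.1] x
  have hvm : ∀ n, Measurable (v n) := by
    intro n
    refine convexHull_min (t := {F | Measurable F}) ?_ ?_ (hv n)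
    · rintro _ ⟨k, -, rfl⟩
      exact hΦm k
    · intro F hF F' hF' a b _ _ _
      exact (hF.const_smul a).add (hF'.const_smul b)
  have hv0 : ∀ n A, 0 ≤ v n A := by
    intro n A
    refine convexHull_min (t := {F : Finset X → ℝ | 0 ≤ F A}) ?_ ?_ (hv n)
    · rintro _ ⟨k, -, rfl⟩
      exact (hΦ01 k A).1
    · intro F hF F' hF' a b ha hb _
      exact add_nonneg (mul_nonneg ha hF) (mul_nonneg hb hF')
  have hv1 : ∀ n x, starSum G K (fun A => v n A.1) x = 1 := by
    intro n x
    refine convexHull_min (t := {F : Finset X → ℝ | starSum G K (fun A => F A.1) x = 1}) ?_ ?_ (hv n)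
    · rintro _ ⟨k, -, rfl⟩
      exact hΦ1 k x
    · intro F (hF : _ = _) F' (hF' : _ = _) a b ha hb hab
      change _ = _
      rw [hstar, hF, hF', mul_one, mul_one, hab]
  -- Since `v n` combines only indices from `n` on, a bound valid for large indices survives the
  -- convex combination.
  have hvb : ∀ n x c, (∀ k, n ≤ k → f k x + ∑ i, f k (s i x) ≤ c) →
      boundarySum G K (fun A => v n A.1) x ≤ c := by
    intro n x c hc
    refine convexHull_min (t := {F : Finset X → ℝ | boundarySum G K (fun A => F A.1) x ≤ c})
      ?_ ?_ (hv n)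
    · rintro _ ⟨k, hk, rfl⟩
      exact (hΦb k x).trans (hc k hk)
    · intro F (hF : boundarySum G K (fun A => F A.1) x ≤ c)
        F' (hF' : boundarySum G K (fun A => F' A.1) x ≤ c) a b ha hb hab
      change boundarySum G K (fun A => (a • F + b • F') A.1) x ≤ c
      rw [hbdry]
      calc _ ≤ a * c + b * c := by gcongr
        _ = c := by rw [← add_mul, hab, one_mul]
  -- The upper limit in `ℝ≥0∞` is defined and measurable everywhere, including where the sequence
  -- diverges.
  set Ψ : KSubset G K → ℝ := fun A =>
    (limsup (fun n => ENNReal.ofReal (v n A.1)) atTop).toReal with hΨ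
  have hΨm : Measurable Ψ := by
    refine Measurable.ennreal_toReal (Measurable.limsup fun n => ?_)
    exact ((hvm n).comp KSubset.measurable_val).ennreal_ofReal
  have hae : ∀ᵐ x ∂μ, ∀ A : KSubset G K, x ∈ A.1 →
      Tendsto (fun n => v n A.1) atTop (𝓝 (Ψ A)) := by
    have h1 : ∀ J, ∀ᵐ x ∂μ, ∃ l, Tendsto (fun n => v n (T J x)) atTop (𝓝 l) := by
      intro J
      exact ae_of_ae_map (p := fun A => ∃ l, Tendsto (fun n => v n A) atTop (𝓝 l))
        (hTm J).aemeasurable (Measure.ae_sum_iff.1 hvlim J)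
    filter_upwards [ae_all_iff.2 h1] with x hx A hxA
    obtain ⟨J, hJ⟩ := A.exists_eq_image hφ hxA
    obtain ⟨l, hl⟩ := hx J
    have hl' : Tendsto (fun n => v n A.1) atTop (𝓝 l) := by
      rw [hJ]; convert hl
    have hl0 : 0 ≤ l := ge_of_tendsto' hl' fun n => hv0 n _
    have h2 : limsup (fun n => ENNReal.ofReal (v n A.1)) atTop = ENNReal.ofReal l :=
      ((ENNReal.continuous_ofReal.tendsto l).comp hl').limsup_eq
    have h3 : Ψ A = l := (congrArg ENNReal.toReal h2).trans (ENNReal.toReal_ofReal hl0)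
    rwa [h3]
  refine ⟨Ψ, ⟨hΨm, fun A => ENNReal.toReal_nonneg, ?_⟩, ?_⟩
  · filter_upwards [hae] with x hx
    have h1 := tendsto_starSum hfin (Φ := fun n A => v n A.1) hx
    simp only [hv1] at h1
    exact tendsto_nhds_unique h1 tendsto_const_nhds |>.symm ▸ rfl
  · have hlim' : ∀ᵐ x ∂μ, ∀ i, Tendsto (fun n => f n (s i x)) atTop (𝓝 ε) :=
      ae_all_iff.2 fun i => ae_of_ae_map (hm i).aemeasurable ((hac i).ae_le hlim)
    filter_upwards [hae, hlim, hlim'] with x hx h1 h2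
    have h3 : Tendsto (fun n => f n x + ∑ i, f n (s i x)) atTop (𝓝 ((m + 1) * ε)) := by
      have := h1.add (tendsto_finsetSum Finset.univ fun i _ => h2 i)
      simp only [Finset.sum_const, Finset.card_univ, Fintype.card_fin, nsmul_eq_mul] at this
      convert this using 2
      ring
    refine le_of_forall_gt_imp_ge_of_dense fun c hc => ?_
    obtain ⟨n₀, hn₀⟩ := eventually_atTop.1 (h3.eventually_le_const hc)
    refine le_of_tendsto (tendsto_boundarySum hfin (Φ := fun n A => v n A.1) hx)
      (eventually_atTop.2 ⟨n₀, fun n hn => hvb n x c fun k hk => hn₀ k (hn.trans hk)⟩)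

theorem IsApproxStronglyHyperfinite.isStronglyFractionallyHyperfinite [StandardBorelSpace X]
    [IsFiniteMeasure μ] (hG : IsBoundedType G μ) (h : IsApproxStronglyHyperfinite G μ) :
    IsStronglyFractionallyHyperfinite G μ := by
  intro ε hε
  obtain ⟨m, s, C, hm, hC, hs⟩ := hG.exists_maps
  obtain ⟨K, hK, hK'⟩ := h (ε / (m + 1)) (by positivity)
  refine ⟨K, hK, ?_⟩
  have := hK'.isStronglyFractionallyHyperfiniteWith hm (fun i =>
    (Measure.absolutelyContinuous_of_le (hC i)).trans Measure.smul_absolutelyContinuous) hs hK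
  rwa [mul_div_cancel₀ _ (by positivity)] at this

end ApproxToFractional

/-! ### Finite-quantifier descriptions of cardinality and connectedness. -/

section ConnectedSets

variable {X : Type u} {G : SimpleGraph X} {K : ℕ}

/-- The right side uses only equalities `v i = v j` and quantifiers over finite sets, so it is a
Borel condition on the tuple `v`; `I` is a set of representatives of the values. -/
theorem card_image_le_iff {n : ℕ} [DecidableEq X] (v : Fin n → X) :
    (Finset.univ.image v).card ≤ K ↔
      ∃ I : Finset (Fin n), I.card ≤ K ∧ ∀ i, ∃ j, j ∈ I ∧ v i = v j := by
  constructor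
  · intro h
    obtain ⟨I, -, hI, hcard⟩ := Finset.exists_subset_injOn_image_eq_of_surjOn
      (Finset.univ : Finset (Fin n)) (Finset.univ.image v) (f := v) (by
        intro y hy
        simpa using hy)
    refine ⟨I, ?_, fun i => ?_⟩
    · rwa [← hcard, Finset.card_image_of_injOn hI] at h
    · have : v i ∈ I.image v := by rw [hcard]; simp
      obtain ⟨j, hj, hji⟩ := Finset.mem_image.1 this
      exact ⟨j, hj, hji.symm⟩
  · rintro ⟨I, hI, h⟩
    refine (Finset.card_le_card (t := I.image v) fun y hy => ?_).trans
      (Finset.card_image_le.trans hI)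
    obtain ⟨i, -, rfl⟩ := Finset.mem_image.1 hy
    obtain ⟨j, hj, hij⟩ := h i
    exact Finset.mem_image.2 ⟨j, hj, hij.symm⟩

/-- A finite set is connected iff it has no proper cut. -/
theorem induce_range_connected_iff {n : ℕ} (v : Fin n → X) :
    (G.induce (Set.range v)).Connected ↔ Nonempty (Fin n) ∧
      ∀ I : Finset (Fin n), (∃ i, i ∈ I) → (∃ j, j ∉ I) →
        ∃ i j, (i ∈ I ∧ j ∉ I) ∧ (v i = v j ∨ G.Adj (v i) (v j)) := by
  classical
  rw [induce_connected_iff, Set.range_nonempty_iff_nonempty]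
  refine and_congr_right fun _ => ⟨fun h I => ?_, fun h => ?_⟩
  · rintro ⟨i, hi⟩ ⟨j, hj⟩
    by_contra! hcon
    have key : ∀ y, JoinedIn G (Set.range v) (v i) y → ∀ k, v k = y → k ∈ I := by
      intro y hy
      induction hy with
      | refl =>
        intro k hk
        by_contra hkI
        exact (hcon i k ⟨hi, hkI⟩).1 hk.symm
      | tail _ h2 ih =>
        intro k hk
        by_contra hkI
        obtain ⟨k', hk'⟩ := h2.2.1
        refine (hcon k' k ⟨ih k' hk', hkI⟩).2 ?_
        rw [hk, hk']
        exact h2.1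
    exact hj (key _ (h _ ⟨i, rfl⟩ _ ⟨j, rfl⟩) j rfl)
  · rintro _ ⟨i, rfl⟩ _ ⟨j, rfl⟩
    by_contra hij
    obtain ⟨k, l, ⟨hk, hl⟩, hkl⟩ := h (Finset.univ.filter fun k => JoinedIn G (Set.range v) (v i) (v k))
      ⟨i, Finset.mem_filter.2 ⟨Finset.mem_univ _, Relation.ReflTransGen.refl⟩⟩ ⟨j, by simpa using hij⟩
    simp only [Finset.mem_filter, Finset.mem_univ, true_and] at hk hl
    rcases hkl with hkl | hkl
    · exact hl (hkl ▸ hk)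
    · exact hl (Relation.ReflTransGen.tail hk ⟨hkl, ⟨k, rfl⟩, ⟨l, rfl⟩⟩)

end ConnectedSets

/-! ### Borel measurability of sums over `K`-subsets. -/

section KSubsetBorel

variable {X : Type u} [MeasurableSpace X] [StandardBorelSpace X] {G : SimpleGraph X} {K : ℕ}

attribute [local instance] finsetMeasurableSpace

theorem measurableSet_isKSubset (hG : MeasurableSet {q : X × X | G.Adj q.1 q.2}) :
    MeasurableSet {L : Finset X | L.card ≤ K ∧ (G.induce (L : Set X)).Connected} := by
  classical
  rw [measurableSet_finset_iff]
  intro n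
  have : {v : Fin n → X | Finset.univ.image v ∈
      {L : Finset X | L.card ≤ K ∧ (G.induce (L : Set X)).Connected}} =
      {v | (∃ I : Finset (Fin n), I.card ≤ K ∧ ∀ i, ∃ j, j ∈ I ∧ v i = v j) ∧ Nonempty (Fin n) ∧
      ∀ I : Finset (Fin n), (∃ i, i ∈ I) → (∃ j, j ∉ I) →
        ∃ i j, (i ∈ I ∧ j ∉ I) ∧ (v i = v j ∨ G.Adj (v i) (v j))} := by
    ext v
    have hrange : ((Finset.univ.image v : Finset X) : Set X) = Set.range v := by simp
    change (Finset.univ.image v).card ≤ K ∧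
      (G.induce ((Finset.univ.image v : Finset X) : Set X)).Connected ↔ _ ∧ _
    rw [← card_image_le_iff, ← induce_range_connected_iff, hrange]
  rw [this]
  have heq : ∀ i j, Measurable fun v : Fin n → X => v i = v j := fun i j =>
    measurableSet_setOfPred.1 (measurableSet_eq_fun (measurable_pi_apply i) (measurable_pi_apply j))
  have hadj : ∀ i j, Measurable fun v : Fin n → X => G.Adj (v i) (v j) := by
    intro i j
    have hp : Measurable fun v : Fin n → X => (v i, v j) :=
      (measurable_pi_apply i).prodMk (measurable_pi_apply j)
    exact measurableSet_setOfPred.1 (hp hG)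
  refine measurableSet_setOfPred.2 (Measurable.and ?_ (Measurable.and measurable_const ?_))
  · exact Measurable.exists fun I => measurable_const.and (Measurable.forall fun i =>
      Measurable.exists fun j => measurable_const.and (heq i j))
  · exact Measurable.forall fun I => measurable_const.imp (measurable_const.imp
      (Measurable.exists fun i => Measurable.exists fun j =>
        measurable_const.and ((heq i j).or (hadj i j))))

/-- This permits extending a measurable `Φ` by zero to all finite sets without losing measurability.
-/
theorem KSubset.measurableEmbedding_val (hG : MeasurableSet {q : X × X | G.Adj q.1 q.2}) :
    MeasurableEmbedding fun A : KSubset G K => A.1 where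
  injective := Subtype.val_injective
  measurable := KSubset.measurable_val
  measurableSet_image' := by
    rintro _ ⟨t, ht, rfl⟩
    convert ht.inter (measurableSet_isKSubset (K := K) hG) using 1
    ext L
    constructor
    · rintro ⟨A, hA, rfl⟩
      exact ⟨hA, A.2⟩
    · rintro ⟨h1, h2⟩
      exact ⟨⟨L, h2⟩, h1, rfl⟩

open Classical in
/-- Sums over the `K`-subsets containing `x` of a measurable function of the `K`-subset, restricted
to the `K`-subsets containing `z` and divided by their cardinality, are jointly measurable. -/
theorem measurable_tsum_kSubset (hG : MeasurableSet {q : X × X | G.Adj q.1 q.2}) {N : ℕ}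
    {φ : Fin N → X → X} (hφm : ∀ j, Measurable (φ j))
    (hφ : ∀ x, ∀ y ∈ graphBall G x K, ∃ j, y = φ j x) {Φ : KSubset G K → ℝ} (hΦ : Measurable Φ) :
    Measurable fun q : X × X => ∑' A : {A : KSubset G K // q.1 ∈ A.1},
      if q.2 ∈ A.1.1 then Φ A.1 / A.1.1.card else 0 := by
  set Φ' : Finset X → ℝ := Function.extend (fun A : KSubset G K => A.1) Φ 0 with hΦ'
  have hΦ'm : Measurable Φ' := (KSubset.measurableEmbedding_val hG).measurable_extend hΦ
    measurable_const
  have hΦ'val : ∀ A : KSubset G K, Φ' A.1 = Φ A := fun A =>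
    Subtype.val_injective.extend_apply Φ 0 A
  set T : Finset (Fin N) → X → Finset X := fun J x => J.image fun j => φ j x with hT
  have hTm : ∀ J, Measurable (T J) := measurable_finset_image hφm
  have hmain : (fun q : X × X => ∑' A : {A : KSubset G K // q.1 ∈ A.1},
      if q.2 ∈ A.1.1 then Φ A.1 / A.1.1.card else 0) = fun q : X × X => ∑ J : Finset (Fin N),
      if (∀ j, j ∈ J → ∀ i, i < j → φ i q.1 ≠ φ j q.1) ∧ (∃ j, j ∈ J ∧ φ j q.1 = q.1) ∧
        (∃ j, j ∈ J ∧ φ j q.1 = q.2) then Φ' (T J q.1) / J.card else 0 := by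
    ext ⟨x, z⟩
    have := finite_kSubset_mem hφ x
    have := Fintype.ofFinite {A : KSubset G K // x ∈ A.1}
    rw [tsum_fintype]
    -- Different `J` can have the same image, so each `A` is counted through its canonical index
    -- set, the least index for every value. The remaining admissible `J` give sets that are not
    -- `K`-subsets, where `Φ'` vanishes.
    set e : {A : KSubset G K // x ∈ A.1} → Finset (Fin N) := fun A =>
      Finset.univ.filter fun j => φ j x ∈ A.1.1 ∧ ∀ i, i < j → φ i x ≠ φ j x with he
    have hTe : ∀ A, T (e A) x = A.1.1 := by
      intro A
      ext y
      simp only [hT, he, Finset.mem_image, Finset.mem_filter, Finset.mem_univ, true_and]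
      constructor
      · rintro ⟨j, hj, rfl⟩
        exact hj.1
      · intro hy
        have hex : ∃ j, φ j x = y := by
          obtain ⟨j, rfl⟩ := hφ x y (A.1.mem_graphBall A.2 hy)
          exact ⟨j, rfl⟩
        obtain ⟨j, hj, hmin⟩ := WellFounded.has_min (wellFounded_lt (α := Fin N)) {j | φ j x = y} hex
        refine ⟨j, ⟨?_, fun i hi hij => hmin i (hij.trans hj) hi⟩, hj⟩
        rwa [show φ j x = y from hj]
    have hinj : ∀ J : Finset (Fin N), (∀ j, j ∈ J → ∀ i, i < j → φ i x ≠ φ j x) →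
        Set.InjOn (fun j => φ j x) J := by
      intro J hJ i hi j hj hij
      by_contra hne
      rcases lt_or_gt_of_ne hne with h | h
      · exact hJ j hj i h hij
      · exact hJ i hi j h hij.symm
    have hcan : ∀ A j, j ∈ e A → ∀ i, i < j → φ i x ≠ φ j x := fun A j hj =>
      ((Finset.mem_filter.1 hj).2).2
    refine Finset.sum_of_injOn e ?_ (fun _ _ => Finset.mem_coe.2 (Finset.mem_univ _)) ?_ ?_
    · intro A _ B _ hAB
      refine Subtype.ext (Subtype.ext ?_)
      rw [← hTe A, ← hTe B, hAB]
    · intro J _ hJ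
      refine ite_eq_right_iff.2 ?_
      rintro ⟨h1, ⟨j₀, hj₀, hx⟩, -⟩
      rw [div_eq_zero_iff]
      left
      refine Function.extend_apply' _ _ _ ?_
      rintro ⟨A, hA⟩
      have hxA : x ∈ A.1 := by
        rw [show A.1 = T J x from hA]
        exact Finset.mem_image.2 ⟨j₀, hj₀, hx⟩
      refine hJ ⟨⟨A, hxA⟩, by simp, ?_⟩
      ext j
      simp only [he, Finset.mem_filter, Finset.mem_univ, true_and, show A.1 = T J x from hA]
      constructor
      · rintro ⟨h2, h3⟩
        obtain ⟨i, hi, hij⟩ := Finset.mem_image.1 h2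
        have : i = j := by
          by_contra hne
          rcases lt_or_gt_of_ne hne with h | h
          · exact h3 i h hij
          · exact h1 i hi j h hij.symm
        exact this ▸ hi
      · intro hj
        exact ⟨Finset.mem_image.2 ⟨j, hj, rfl⟩, h1 j hj⟩
    · intro A _
      have hmem : ∀ y, y ∈ A.1.1 ↔ ∃ j, j ∈ e A ∧ φ j x = y := fun y => by
        rw [← hTe A]; simp [hT]
      have hcard : A.1.1.card = (e A).card := by
        rw [← hTe A]
        exact Finset.card_image_of_injOn (hinj _ (hcan A))
      rw [hTe A, ← hcard]
      by_cases hz : z ∈ A.1.1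
      · rw [if_pos hz, if_pos ⟨hcan A, (hmem x).1 A.2, (hmem z).1 hz⟩]
        exact congrArg (· / _) (hΦ'val A.1).symm
      · rw [if_neg hz, if_neg fun h => hz ((hmem z).2 h.2.2)]
  rw [hmain]
  refine Finset.measurable_sum _ fun J _ => Measurable.ite ?_
    (((hΦ'm.comp ((hTm J).comp measurable_fst))).div_const _) measurable_const
  have heq : ∀ {f g : X × X → X}, Measurable f → Measurable g →
      Measurable fun q => f q = g q := fun hf hg =>
    measurableSet_setOfPred.1 (measurableSet_eq_fun hf hg)
  have h1 : ∀ j, Measurable fun q : X × X => φ j q.1 := fun j => (hφm j).comp measurable_fst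
  refine measurableSet_setOfPred.2 (Measurable.and ?_ (Measurable.and ?_ ?_))
  · exact Measurable.forall fun j => measurable_const.imp (Measurable.forall fun i =>
      measurable_const.imp (heq (h1 i) (h1 j)).not)
  · exact Measurable.exists fun j => measurable_const.and (heq (h1 j) measurable_fst)
  · exact Measurable.exists fun j => measurable_const.and (heq (h1 j) measurable_snd)

end KSubsetBorel

/-! ### From fractional partitions to uniform amenability. -/

section FractionalToAmenable

variable {X : Type u} {G : SimpleGraph X} {K : ℕ}

open Classical in
/-- The average of the uniform distributions on the `K`-subsets containing `x`, with weights `Φ`. -/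
noncomputable def averagedDistribution (G : SimpleGraph X) (K : ℕ) (Φ : KSubset G K → ℝ)
    (x z : X) : ℝ :=
  ∑' A : {A : KSubset G K // x ∈ A.1}, if z ∈ A.1.1 then Φ A.1 / A.1.1.card else 0

theorem tsum_subtype_eq_sum {α : Type*} {p : α → Prop} (h : Finite {a // p a}) (f : α → ℝ) :
    ∑' a : {a // p a}, f a = ∑ a ∈ (@Set.toFinite _ {a | p a} h).toFinset, f a := by
  have := Fintype.ofFinite {a // p a}
  rw [tsum_fintype]
  exact (Finset.sum_subtype _ (fun a => by simp) f).symm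

theorem starSum_eq_sum (hfin : ∀ x, Finite {A : KSubset G K // x ∈ A.1}) (Φ : KSubset G K → ℝ)
    (x : X) : starSum G K Φ x =
      ∑ A ∈ (@Set.toFinite _ {A : KSubset G K | x ∈ A.1} (hfin x)).toFinset, Φ A :=
  tsum_subtype_eq_sum (p := fun A : KSubset G K => x ∈ A.1) (hfin x) Φ

theorem sum_le_boundarySum (hfin : ∀ x, Finite {A : KSubset G K // x ∈ A.1}) {Φ : KSubset G K → ℝ}
    (hΦ : ∀ A, 0 ≤ Φ A) {x : X} {S : Finset (KSubset G K)}
    (hS : ∀ A ∈ S, x ∈ innerBoundary G (A.1 : Set X)) : ∑ A ∈ S, Φ A ≤ boundarySum G K Φ x := by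
  have := finite_innerBoundary hfin x
  unfold boundarySum
  rw [tsum_subtype_eq_sum (p := fun A : KSubset G K => x ∈ innerBoundary G (A.1 : Set X)) this Φ]
  exact Finset.sum_le_sum_of_subset_of_nonneg
    (fun A hA => (Set.Finite.mem_toFinset _).2 (hS A hA)) fun A _ _ => hΦ A

open Classical in
theorem hasSum_kSubset_uniform (Φ : KSubset G K → ℝ) (A : KSubset G K) :
    HasSum (fun z => if z ∈ A.1 then Φ A / A.1.card else 0) (Φ A) := by
  have hne : (A.1.card : ℝ) ≠ 0 := by
    obtain ⟨x, hx⟩ := (induce_connected_iff.1 A.2.2).1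
    exact_mod_cast (Finset.card_pos.2 ⟨x, hx⟩).ne'
  have h : HasSum (fun z => if z ∈ A.1 then Φ A / A.1.card else 0)
      (∑ z ∈ A.1, if z ∈ A.1 then Φ A / A.1.card else 0) :=
    hasSum_sum_of_ne_finset_zero fun z hz => if_neg hz
  have h2 : ∑ z ∈ A.1, (if z ∈ A.1 then Φ A / A.1.card else 0) = Φ A := by
    rw [Finset.sum_congr rfl fun z hz => if_pos hz, Finset.sum_const, nsmul_eq_mul,
      mul_div_cancel₀ _ hne]
  rwa [h2] at h

theorem averagedDistribution_nonneg {Φ : KSubset G K → ℝ} (hΦ : ∀ A, 0 ≤ Φ A) (x z : X) :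
    0 ≤ averagedDistribution G K Φ x z := by
  refine tsum_nonneg fun A => ?_
  split_ifs
  · exact div_nonneg (hΦ _) (Nat.cast_nonneg _)
  · exact le_rfl

open Classical in
theorem averagedDistribution_eq_sum (hfin : ∀ x, Finite {A : KSubset G K // x ∈ A.1})
    (Φ : KSubset G K → ℝ) (x z : X) : averagedDistribution G K Φ x z =
      ∑ A ∈ (@Set.toFinite _ {A : KSubset G K | x ∈ A.1} (hfin x)).toFinset,
        if z ∈ A.1 then Φ A / A.1.card else 0 :=
  tsum_subtype_eq_sum (p := fun A : KSubset G K => x ∈ A.1) (hfin x)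
    fun A => if z ∈ A.1 then Φ A / A.1.card else 0

theorem hasSum_averagedDistribution (hfin : ∀ x, Finite {A : KSubset G K // x ∈ A.1})
    (Φ : KSubset G K → ℝ) (x : X) :
    HasSum (averagedDistribution G K Φ x) (starSum G K Φ x) := by
  classical
  rw [starSum_eq_sum hfin, funext (averagedDistribution_eq_sum hfin Φ x)]
  exact hasSum_sum fun A _ => hasSum_kSubset_uniform Φ A

theorem support_averagedDistribution_subset (hfin : ∀ x, Finite {A : KSubset G K // x ∈ A.1})
    (Φ : KSubset G K → ℝ) (x : X) :
    Function.support (averagedDistribution G K Φ x) ⊆ graphBall G x K := by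
  classical
  intro z hz
  rw [Function.mem_support, averagedDistribution_eq_sum hfin] at hz
  obtain ⟨A, hA, hne⟩ := Finset.exists_ne_zero_of_sum_ne_zero hz
  have hzA : z ∈ A.1 := by
    by_contra h
    exact hne (if_neg h)
  have hxA : A ∈ {A : KSubset G K | x ∈ A.1} := (Set.Finite.mem_toFinset _).1 hA
  exact A.mem_graphBall hxA hzA

/-- Sets containing both `x` and `y` cancel. A set containing just one of them has that point on its
inner boundary, the other being an outside neighbour, and contributes total mass `Φ A`. -/
theorem tsum_abs_averagedDistribution_sub_le (hfin : ∀ x, Finite {A : KSubset G K // x ∈ A.1})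
    {Φ : KSubset G K → ℝ} (hΦ : ∀ A, 0 ≤ Φ A) {x y : X} (hxy : G.Adj x y) :
    ∑' z, |averagedDistribution G K Φ x z - averagedDistribution G K Φ y z| ≤
      boundarySum G K Φ x + boundarySum G K Φ y := by
  classical
  set S : X → Finset (KSubset G K) := fun x =>
    (@Set.toFinite _ {A : KSubset G K | x ∈ A.1} (hfin x)).toFinset with hS
  have hmem : ∀ x A, A ∈ S x ↔ x ∈ A.1 := fun x A => Set.Finite.mem_toFinset _
  set w : KSubset G K → X → ℝ := fun A z => if z ∈ A.1 then Φ A / A.1.card else 0 with hw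
  have hw0 : ∀ A z, 0 ≤ w A z := by
    intro A z
    simp only [hw]
    split_ifs
    · exact div_nonneg (hΦ _) (Nat.cast_nonneg _)
    · exact le_rfl
  have hle : ∀ z, |averagedDistribution G K Φ x z - averagedDistribution G K Φ y z| ≤
      ∑ A ∈ S x \ S y, w A z + ∑ A ∈ S y \ S x, w A z := by
    intro z
    rw [averagedDistribution_eq_sum hfin, averagedDistribution_eq_sum hfin]
    change |∑ A ∈ S x, w A z - ∑ A ∈ S y, w A z| ≤ _
    rw [← Finset.sum_sdiff_sub_sum_sdiff]
    refine (abs_sub _ _).trans_eq ?_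
    rw [abs_of_nonneg (Finset.sum_nonneg fun A _ => hw0 A z),
      abs_of_nonneg (Finset.sum_nonneg fun A _ => hw0 A z)]
  have hsum : HasSum (fun z => ∑ A ∈ S x \ S y, w A z + ∑ A ∈ S y \ S x, w A z)
      (∑ A ∈ S x \ S y, Φ A + ∑ A ∈ S y \ S x, Φ A) :=
    (hasSum_sum fun A _ => hasSum_kSubset_uniform Φ A).add
      (hasSum_sum fun A _ => hasSum_kSubset_uniform Φ A)
  have hsm : Summable fun z =>
      |averagedDistribution G K Φ x z - averagedDistribution G K Φ y z| :=
    Summable.of_nonneg_of_le (fun _ => abs_nonneg _) hle hsum.summable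
  refine (hsm.tsum_le_tsum hle hsum.summable).trans ?_
  rw [hsum.tsum_eq]
  refine add_le_add (sum_le_boundarySum hfin hΦ fun A hA => ?_)
    (sum_le_boundarySum hfin hΦ fun A hA => ?_)
  · rw [Finset.mem_sdiff, hmem, hmem] at hA
    exact ⟨hA.1, y, hA.2, hxy⟩
  · rw [Finset.mem_sdiff, hmem, hmem] at hA
    exact ⟨hA.1, x, hA.2, hxy.symm⟩

variable [MeasurableSpace X] {μ : Measure X}

/-- A property that holds almost everywhere holds on an invariant Borel set of full measure. -/
theorem IsMeasuredGraph.exists_invariant_conull (hG : IsMeasuredGraph G μ) {P : X → Prop}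
    (hP : ∀ᵐ x ∂μ, P x) :
    ∃ Y : Set X, MeasurableSet Y ∧ IsInvariant G Y ∧ μ Yᶜ = 0 ∧ ∀ x ∈ Y, P x := by
  obtain ⟨s, hm, hac, hs⟩ := hG.exists_maps
  have hwac : ∀ l, μ.map (wordMap s l) ≪ μ := by
    intro l
    induction l with
    | nil => exact (Measure.map_id (μ := μ)).absolutelyContinuous
    | cons i l ih =>
      have h1 : μ.map (wordMap s (i :: l)) = (μ.map (s i)).map (wordMap s l) :=
        (Measure.map_map (measurable_wordMap hm l) (hm i)).symm
      rw [h1]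
      exact ((hac i).map (measurable_wordMap hm l)).trans ih
  set Z := (toMeasurable μ {x | ¬ P x})ᶜ with hZ
  have hZm : MeasurableSet Z := (measurableSet_toMeasurable _ _).compl
  have hZ0 : μ Zᶜ = 0 := by
    rw [hZ, compl_compl, measure_toMeasurable]
    exact hP
  -- Points whose whole orbit stays in `Z`: the empty word gives `P`, prefixing a letter gives
  -- invariance, and quasi-invariance keeps the complement null.
  refine ⟨⋂ l, wordMap s l ⁻¹' Z, MeasurableSet.iInter fun l =>
    hZm.preimage (measurable_wordMap hm l), isInvariant_of_adj ?_, ?_, ?_⟩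
  · intro x hx y hxy
    obtain ⟨i, rfl⟩ := ((hs x y).1 hxy).2
    exact Set.mem_iInter.2 fun l => Set.mem_iInter.1 hx (i :: l)
  · rw [Set.compl_iInter, measure_iUnion_null_iff]
    intro l
    have := hwac l hZ0
    rwa [Measure.map_apply (measurable_wordMap hm l) hZm.compl] at this
  · intro x hx
    by_contra hcon
    exact (Set.mem_iInter.1 hx []) (subset_toMeasurable _ _ hcon)

theorem IsStronglyFractionallyHyperfinite.isUniformlyAmenable [StandardBorelSpace X]
    [IsProbabilityMeasure μ] (hG : IsBoundedType G μ)
    (h : IsStronglyFractionallyHyperfinite G μ) : IsUniformlyAmenable G μ := by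
  intro ε hε
  obtain ⟨d, hd⟩ := hG.2.1
  obtain ⟨m, s, C, hm, hC, hs⟩ := hG.exists_maps
  -- Each of at most `d` neighbours costs two boundary sums; `d + 1` avoids division by zero.
  obtain ⟨K, hK, Φ, ⟨hΦm, hΦ0, hΦ1⟩, hΦb⟩ := h (ε / (2 * (d + 1))) (by positivity)
  obtain ⟨N, φ, hφm, hφ⟩ := exists_maps_graphBall_subset hm (fun x y h => ((hs x y).1 h).2) K
  have hfin : ∀ x, Finite {A : KSubset G K // x ∈ A.1} := finite_kSubset_mem hφ
  obtain ⟨Y, hY, hYinv, hY0, hYP⟩ := hG.1.exists_invariant_conull (hΦ1.and hΦb)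
  refine ⟨K, hK, Y, hY, hYinv, (prob_compl_eq_zero_iff hY).1 hY0, averagedDistribution G K Φ,
    measurable_tsum_kSubset hG.1.1 hφm hφ hΦm, fun x hx =>
    ⟨averagedDistribution_nonneg hΦ0 x, ?_, support_averagedDistribution_subset hfin Φ x, ?_⟩⟩
  · have := hasSum_averagedDistribution hfin Φ x
    rwa [(hYP x hx).1] at this
  · have hnf : (G.neighborSet x).Finite := Set.finite_of_encard_le_coe (hd x)
    have : Fintype (G.neighborSet x) := hnf.fintype
    have hcard : (Fintype.card (G.neighborSet x) : ℝ) ≤ d := by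
      have h1 := hd x
      rw [Set.encard_eq_coe_toFinset_card, Set.toFinset_card] at h1
      exact_mod_cast h1
    rw [tsum_fintype]
    have hle : ∀ y : G.neighborSet x,
        ∑' z, |averagedDistribution G K Φ x z - averagedDistribution G K Φ y z| ≤ ε / (d + 1) := by
      intro y
      refine (tsum_abs_averagedDistribution_sub_le hfin hΦ0 y.2).trans ?_
      have h1 := (hYP x hx).2
      have h2 := (hYP y (hYinv.mem_of_adj hx y.2)).2
      have h3 : ε / (d + 1) = ε / (2 * (d + 1)) + ε / (2 * (d + 1)) := by field_simp; ring
      rw [h3]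
      exact add_le_add h1 h2
    calc _ ≤ ∑ _y : G.neighborSet x, ε / (d + 1) := Finset.sum_le_sum fun y _ => hle y
      _ = Fintype.card (G.neighborSet x) * (ε / (d + 1)) := by simp
      _ ≤ d * (ε / (d + 1)) := by gcongr
      _ ≤ ε := by
        rw [mul_div_assoc', div_le_iff₀ (by positivity)]
        nlinarith

end FractionalToAmenable

end UniformHyperfinite

/-! ### The cycle of implications. -/

theorem theorem1 {X : Type*} [MeasurableSpace X] [StandardBorelSpace X]
    (G : SimpleGraph X) (μ : MeasureTheory.Measure X) [MeasureTheory.IsProbabilityMeasure μ]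
    (hG : UniformHyperfinite.IsMeasuredGraph G μ) :
    (UniformHyperfinite.IsBoundedType G μ →
      (UniformHyperfinite.IsUniformlyAmenable G μ ↔
        UniformHyperfinite.IsUniformlyHyperfinite G μ) ∧
      List.TFAE
        [UniformHyperfinite.IsUniformlyAmenable G μ,
         UniformHyperfinite.IsUniformlyLocallyHyperfinite G μ,
         UniformHyperfinite.IsUniformlyHyperfinite G μ,
         UniformHyperfinite.IsWeightedHyperfinite G μ,
         UniformHyperfinite.IsApproxStronglyHyperfinite G μ,
         UniformHyperfinite.IsStronglyFractionallyHyperfinite G μ]) ∧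
    (UniformHyperfinite.BoundedDegree G →
      UniformHyperfinite.IsUniformlyAmenable G μ →
        UniformHyperfinite.IsUniformlyHyperfinite G μ) := by
  refine ⟨fun hB => ?_, fun hd h =>
    (h.isUniformlyLocallyHyperfinite hG hd).isUniformlyHyperfinite hG⟩
  have tfae : List.TFAE
        [UniformHyperfinite.IsUniformlyAmenable G μ,
         UniformHyperfinite.IsUniformlyLocallyHyperfinite G μ,
         UniformHyperfinite.IsUniformlyHyperfinite G μ,
         UniformHyperfinite.IsWeightedHyperfinite G μ,
         UniformHyperfinite.IsApproxStronglyHyperfinite G μ,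
         UniformHyperfinite.IsStronglyFractionallyHyperfinite G μ] := by
    tfae_have 1 → 2 := fun h => h.isUniformlyLocallyHyperfinite hG hB.2.1
    tfae_have 2 → 3 := fun h => h.isUniformlyHyperfinite hG
    tfae_have 3 → 4 := fun h => h.isWeightedHyperfinite hB
    tfae_have 4 → 5 := fun h ε hε =>
      let ⟨K, hK, hw⟩ := h ε hε
      ⟨K, hK, hw.isApproxStronglyHyperfiniteWith⟩
    tfae_have 5 → 6 := fun h => h.isStronglyFractionallyHyperfinite hB
    tfae_have 6 → 1 := fun h => h.isUniformlyAmenable hB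
    tfae_finish
  exact ⟨tfae.out 0 2, tfae⟩
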